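/- Let $\rho_s,u_s,a,\mu,\kappa>0$ and $\gamma\ge 1$ be real constants, and put $b=a\gamma\rho_s^{\gamma-2}$. Let $L^2(0,2\pi)$ be the space of complex-valued square-integrable functions on $(0,2\pi)$ and $\dot L^2(0,2\pi)=\{g\in L^2(0,2\pi):\int_0^{2\pi}g(x)\,dx=0\}$. Consider the one-dimensional compressible Navier--Stokes system with Maxwell's law, linearized around $(\rho_s,u_s,0)$, with a control $f$ acting on the whole interval in the density equation only: $$ \begin{cases} \partial_t\rho+u_s\,\partial_x\rho+\rho_s\,\partial_x u=f & \text{in }(0,T)\times(0,2\pi),\\ \partial_t u+u_s\,\partial_x u+b\,\partial_x\rho-\frac1{\rho_s}\partial_x S=0 & \text{in }(0,T)\times(0,2\pi),\\ \partial_t S+\frac1\kappa S-\frac{\mu}{\kappa}\,\partial_x u=0 & \text{in }(0,T)\times(0,2\pi),\\ \rho(t,0)=\rho(t,2\pi),\quad u(t,0)=u(t,2\pi),\quad S(t,0)=S(t,2\pi) & t\in(0,T),\\ (\rho,u,S)(0,\cdot)=(\rho_0,u_0,S_0) & \text{in }(0,2\pi). \end{cases} $$ A solution is a triple $(\rho,u,S)\in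 C([0,T];L^2(0,2\pi)^3)$ with $(\rho,u,S)(0)=(\rho_0,u_0,S_0)$ that satisfies the equations and the boundary conditions in the weak sense, that is, tested in $x$ against all smooth $2\pi$-periodic functions and integrated over $[0,t]$, for every $t\in[0,T]$. Then for every $T>0$ the system is exactly controllable at time $T$ in $L^2(0,2\pi)\times\dot L^2(0,2\pi)\times\dot L^2(0,2\pi)$: for all $(\rho_0,u_0,S_0)$ and $(\rho_1,u_1,S_1)$ in this space there is a control $f\in L^2(0,T;L^2(0,2\pi))$ such that the system has a unique solution $(\rho,u,S)$, and this solution satisfies $(\rho,u,S)(T,\cdot)=(\rho_1,u_1,S_1)$ in $L^2(0,2\pi)^3$. -/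

import Mathlib

open MeasureTheory
open scoped ContDiff

noncomputable section

namespace MaxwellNS

/-- Lebesgue measure on the interval `(0, 2π)`. -/
abbrev spaceMeasure : Measure ℝ := volume.restrict (Set.Ioo 0 (2 * Real.pi))

/-- The complex Hilbert space `L²(0, 2π)`. -/
abbrev L2 : Type := Lp ℂ 2 spaceMeasure

/-- The state space `L²(0,2π) × L²(0,2π) × L²(0,2π)` of triples `(ρ, u, S)`, with the product
topology. -/
abbrev State : Type := L2 × L2 × L2

/-- The space `L²(0,2π) × L̇²(0,2π) × L̇²(0,2π)`: velocity and stress have zero mean. -/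
def Zm : Set State :=
  {z | (∫ x, z.2.1 x ∂spaceMeasure) = 0 ∧ (∫ x, z.2.2 x ∂spaceMeasure) = 0}

/-- The pairing `∫₀^{2π} g(x) φ(x) dx`. -/
def pair (g : L2) (φ : ℝ → ℂ) : ℂ := ∫ x, g x * φ x ∂spaceMeasure

/-- Physical constants: steady density `ρs`, steady velocity `us`, pressure law `p(ρ) = a ρ ^ γ`,
viscosity `μ`, relaxation time `κ`. -/
structure Params where
  (ρs us a γ μ κ : ℝ)

/-- The standing assumptions on the physical constants. -/
structure Params.Admissible (p : Params) : Prop where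
  ρs_pos : 0 < p.ρs
  us_pos : 0 < p.us
  a_pos : 0 < p.a
  one_le_γ : 1 ≤ p.γ
  μ_pos : 0 < p.μ
  κ_pos : 0 < p.κ

/-- The coefficient `a γ ρs ^ (γ - 2)`. -/
def Params.b (p : Params) : ℝ := p.a * p.γ * p.ρs ^ (p.γ - 2)

/-- `z = (ρ, u, S) ∈ C([0,T]; L² × L² × L²)` is the (weak) solution on `[0, T]`, with source terms
`f₁, f₂, f₃` and initial datum `z₀`, of
`∂ₜρ + us ∂ₓρ + ρs ∂ₓu = f₁`,
`∂ₜu + us ∂ₓu + b ∂ₓρ - (1/ρs) ∂ₓS = f₂`,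
`∂ₜS + (1/κ) S - (μ/κ) ∂ₓu = f₃`,
with periodic boundary conditions on `(0, 2π)`. The equations are tested in `x` against all smooth
`2π`-periodic functions, which also encodes the boundary conditions, and integrated in time. -/
structure IsSolution (p : Params) (T : ℝ) (f₁ f₂ f₃ : ℝ → L2) (z₀ : State) (z : ℝ → State) :
    Prop where
  continuousOn : ContinuousOn z (Set.Icc 0 T)
  initial : z 0 = z₀
  density : ∀ φ : ℝ → ℂ, ContDiff ℝ ∞ φ → Function.Periodic φ (2 * Real.pi) →
    ∀ t ∈ Set.Icc 0 T,
      pair (z t).1 φ = pair z₀.1 φ + ∫ s in (0 : ℝ)..t,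
        ((p.us : ℂ) * pair (z s).1 (deriv φ) + (p.ρs : ℂ) * pair (z s).2.1 (deriv φ)
          + pair (f₁ s) φ)
  velocity : ∀ φ : ℝ → ℂ, ContDiff ℝ ∞ φ → Function.Periodic φ (2 * Real.pi) →
    ∀ t ∈ Set.Icc 0 T,
      pair (z t).2.1 φ = pair z₀.2.1 φ + ∫ s in (0 : ℝ)..t,
        ((p.us : ℂ) * pair (z s).2.1 (deriv φ) + (p.b : ℂ) * pair (z s).1 (deriv φ)
          - (1 / p.ρs : ℂ) * pair (z s).2.2 (deriv φ) + pair (f₂ s) φ)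
  stress : ∀ φ : ℝ → ℂ, ContDiff ℝ ∞ φ → Function.Periodic φ (2 * Real.pi) →
    ∀ t ∈ Set.Icc 0 T,
      pair (z t).2.2 φ = pair z₀.2.2 φ + ∫ s in (0 : ℝ)..t,
        (-(1 / p.κ : ℂ) * pair (z s).2.2 φ - (p.μ / p.κ : ℂ) * pair (z s).2.1 (deriv φ)
          + pair (f₃ s) φ)

/-- Exact controllability at time `T` in the set `V` of states by a control
`f ∈ L²(0,T; L²(0,2π))` acting everywhere in the density equation (and in no other equation): for
all `z₀, z₁ ∈ V` there is a control `f` such that the system has a unique solution starting at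
`z₀`, and that solution equals `z₁` at time `T`. -/
def ExactlyControllableByDensity (p : Params) (T : ℝ) (V : Set State) : Prop :=
  ∀ z₀ ∈ V, ∀ z₁ ∈ V, ∃ f : ℝ → L2, MemLp f 2 (volume.restrict (Set.Ioo 0 T)) ∧
    ∃ z : ℝ → State, IsSolution p T f 0 0 z₀ z ∧
      (∀ w : ℝ → State, IsSolution p T f 0 0 z₀ w → Set.EqOn w z (Set.Icc 0 T)) ∧
      z T = z₁

end MaxwellNS

end

/-! Fourier series in `x` split the system into independent 3×3 linear ODEs, one for each frequency
`n`, with a scalar control in the first equation. Each mode with `n ≠ 0` is controllable; what has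
to be proved is that the cost of control stays bounded as `|n| → ∞`, so that the modal controls and
states can be summed in `L²`. The control acts at every point of the circle, so no time is needed
for waves to travel, and any `T > 0` suffices.

After rescaling the unknowns (`exists_mode_control`), the generator is skew-Hermitian apart from the
damping of the stress. Duality (`exists_control_of_observable`) reduces uniform control to a uniform
observability inequality for the adjoint modes `(σ, v, q)`, in which only `σ` is seen. This is
`observability`, proved by multipliers: the derivative of `k⁻¹ Im (σ v̄)` produces `|v|²` up to
terms in `σ`, and that of `k⁻¹ Im (v q̄)` trades `|q|²` for `|v|²`. The factor `k⁻¹` cancels the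
frequency in the equations, so every constant is independent of `k`. Powers of `t (T - t)` remove
the boundary terms, and `multiplier_quadratic_bound` does the absorption. The energy of the adjoint
decays at a bounded rate, so observing its minimum over `[0, T]` is enough.

At `n = 0` the velocity is constant and the stress decays freely, which is why both must have zero
mean; the mean density is moved directly by the control.

The bounds give a square-summable majorant, hence continuous `L²`-valued curves
(`exists_continuous_of_coeff`), which are weak solutions by `pair_eq_add_integral`. Uniqueness is
ODE uniqueness for each mode, followed by completeness of the exponentials. -/

noncomputable section

/-! ### Multiplier estimate and uniform observability of the adjoint modes -/

namespace MaxwellNS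

open ComplexConjugate

/-- The pointwise inequality behind the multiplier estimate. -/
lemma multiplier_quadratic_bound {T u α β κ : ℝ} (hT : 0 < T) (hu : 0 < u) (hα : 0 < α)
    (hβ : 0 < β) (hκ : 0 < κ) :
    ∃ L K c : ℝ, 0 < L ∧ 0 < K ∧ 0 < c ∧ ∀ θ θ' S V Q P' Q' P₀ Q₀ : ℝ,
      0 ≤ θ → θ ≤ T ^ 2 → |θ'| ≤ T → 0 ≤ S → 0 ≤ V → 0 ≤ Q →
      |P₀| ≤ S * V → |Q₀| ≤ V * Q →
      α * (V ^ 2 - S ^ 2) - β * (S * Q) ≤ P' →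
      Q' ≤ (u + κ⁻¹) * (V * Q) + α * (S * Q) + β * (V ^ 2 - Q ^ 2) →
      c * (θ ^ 4 * (S ^ 2 + V ^ 2 + Q ^ 2)) - K * S ^ 2 ≤
        L * (2 * θ * θ' * P₀ + θ ^ 2 * P') - (4 * θ ^ 3 * θ' * Q₀ + θ ^ 4 * Q') := by
  obtain ⟨Θ, hΘ⟩ : ∃ Θ, Θ = T ^ 2 := ⟨_, rfl⟩
  have hΘ0 : 0 < Θ := by rw [hΘ]; positivity
  obtain ⟨a, ha⟩ : ∃ a, a = 4 * T + Θ * (u + κ⁻¹) := ⟨_, rfl⟩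
  have ha0 : 0 < a := by rw [ha]; positivity
  -- `L * α` is the coefficient of the good term `X ^ 2` below. It pays for the cross term `a X Y`
  -- after Young, for `β Θ² X²`, once for `S X`, and leaves one `X ^ 2` over.
  obtain ⟨L, hL⟩ : ∃ L, L = (a ^ 2 / β + β * Θ ^ 2 + 2) / α := ⟨_, rfl⟩
  have hL0 : 0 < L := by rw [hL]; positivity
  have hLα : L * α = a ^ 2 / β + β * Θ ^ 2 + 2 := by rw [hL]; field_simp
  obtain ⟨d, hd⟩ : ∃ d, d = L * β + α * Θ ^ 2 := ⟨_, rfl⟩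
  have hd0 : 0 < d := by rw [hd]; positivity
  obtain ⟨K, hK⟩ : ∃ K, K = L * α * Θ ^ 2 + d ^ 2 / β + L ^ 2 * T ^ 2 := ⟨_, rfl⟩
  have hK0 : 0 < K := by rw [hK]; positivity
  obtain ⟨C, hC⟩ : ∃ C, C = Θ ^ 4 + Θ ^ 2 + 2 / β := ⟨_, rfl⟩
  have hC0 : 0 < C := by rw [hC]; positivity
  refine ⟨L, K + 1, C⁻¹, hL0, by positivity, by positivity, ?_⟩
  intro θ θ' S V Q P' Q' P₀ Q₀ h0 hθ hθ' hS hV hQ hP₀ hQ₀ hP' hQ'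
  rw [← hΘ] at hθ
  -- The weights `θ²` and `θ⁴` are matched so that the worst term, `θ³ θ' V Q`, is exactly `θ' X Y`
  -- with no negative power of `θ`.
  obtain ⟨X, hX⟩ : ∃ X, X = θ * V := ⟨_, rfl⟩
  obtain ⟨Y, hY⟩ : ∃ Y, Y = θ ^ 2 * Q := ⟨_, rfl⟩
  have hX0 : 0 ≤ X := by rw [hX]; positivity
  have hY0 : 0 ≤ Y := by rw [hY]; positivity
  have hθ2 : θ ^ 2 ≤ Θ ^ 2 := pow_le_pow_left₀ h0 hθ 2
  have hθ4 : θ ^ 4 ≤ Θ ^ 4 := pow_le_pow_left₀ h0 hθ 4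
  have t1 : -(T * (S * X)) ≤ θ * θ' * P₀ := by
    have : |θ * θ' * P₀| ≤ T * (S * X) := by
      rw [abs_mul, abs_mul, abs_of_nonneg h0]
      calc θ * |θ'| * |P₀| ≤ θ * T * (S * V) := by gcongr
        _ = T * (S * X) := by rw [hX]; ring
    linarith [neg_abs_le (θ * θ' * P₀)]
  have t2 : θ ^ 3 * θ' * Q₀ ≤ T * (X * Y) := by
    have : |θ ^ 3 * θ' * Q₀| ≤ T * (X * Y) := by
      rw [abs_mul, abs_mul, abs_of_nonneg (pow_nonneg h0 3)]
      calc θ ^ 3 * |θ'| * |Q₀| ≤ θ ^ 3 * T * (V * Q) := by gcongr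
        _ = T * (X * Y) := by rw [hX, hY]; ring
    linarith [le_abs_self (θ ^ 3 * θ' * Q₀)]
  have t3 : α * X ^ 2 - α * (Θ ^ 2 * S ^ 2) - β * (S * Y) ≤ θ ^ 2 * P' := by
    have h1 := mul_le_mul_of_nonneg_left hP' (sq_nonneg θ)
    have h2 : α * (θ ^ 2 * S ^ 2) ≤ α * (Θ ^ 2 * S ^ 2) := by gcongr
    have h3 : θ ^ 2 * (α * (V ^ 2 - S ^ 2) - β * (S * Q)) =
      α * X ^ 2 - α * (θ ^ 2 * S ^ 2) - β * (S * Y) := by rw [hX, hY]; ring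
    linarith
  have t4 : θ ^ 4 * Q' ≤ Θ * (u + κ⁻¹) * (X * Y) + α * (Θ ^ 2 * (S * Y)) + β * Θ ^ 2 * X ^ 2
      - β * Y ^ 2 := by
    have h1 := mul_le_mul_of_nonneg_left hQ' (pow_nonneg h0 4)
    have h2 : θ * (u + κ⁻¹) * (X * Y) ≤ Θ * (u + κ⁻¹) * (X * Y) := by gcongr
    have h3 : α * (θ ^ 2 * (S * Y)) ≤ α * (Θ ^ 2 * (S * Y)) := by gcongr
    have h4 : β * θ ^ 2 * X ^ 2 ≤ β * Θ ^ 2 * X ^ 2 := by gcongr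
    have h5 : θ ^ 4 * ((u + κ⁻¹) * (V * Q) + α * (S * Q) + β * (V ^ 2 - Q ^ 2)) =
      θ * (u + κ⁻¹) * (X * Y) + α * (θ ^ 2 * (S * Y)) + β * θ ^ 2 * X ^ 2 - β * Y ^ 2 := by
      rw [hX, hY]; ring
    linarith
  -- Young's inequality: the two cross terms containing `Y` each use a quarter of `β Y ^ 2`, so half
  -- of it survives.
  have y1 : a * (X * Y) ≤ β / 4 * Y ^ 2 + a ^ 2 / β * X ^ 2 := by
    have : 0 ≤ β * (Y / 2 - a / β * X) ^ 2 := by positivity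
    have e : β * (Y / 2 - a / β * X) ^ 2 = β / 4 * Y ^ 2 + a ^ 2 / β * X ^ 2 - a * (X * Y) := by
      field_simp; ring
    linarith
  have y2 : d * (S * Y) ≤ β / 4 * Y ^ 2 + d ^ 2 / β * S ^ 2 := by
    have : 0 ≤ β * (Y / 2 - d / β * S) ^ 2 := by positivity
    have e : β * (Y / 2 - d / β * S) ^ 2 = β / 4 * Y ^ 2 + d ^ 2 / β * S ^ 2 - d * (S * Y) := by
      field_simp; ring
    linarith
  have y3 : 2 * L * T * (S * X) ≤ X ^ 2 + L ^ 2 * T ^ 2 * S ^ 2 := by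
    linarith [sq_nonneg (X - L * T * S)]
  have main : X ^ 2 + β / 2 * Y ^ 2 - K * S ^ 2 ≤
      L * (2 * θ * θ' * P₀ + θ ^ 2 * P') - (4 * θ ^ 3 * θ' * Q₀ + θ ^ 4 * Q') := by
    have g1 := mul_le_mul_of_nonneg_left t1 hL0.le
    have g3 := mul_le_mul_of_nonneg_left t3 hL0.le
    have e1 : L * (α * X ^ 2 - α * (Θ ^ 2 * S ^ 2) - β * (S * Y)) =
      (L * α) * X ^ 2 - L * α * Θ ^ 2 * S ^ 2 - L * β * (S * Y) := by ring
    rw [e1, hLα] at g3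
    rw [hd] at y2
    rw [ha] at y1
    rw [hK, hLα, hd]
    rw [ha] at g3 ⊢
    linarith
  have hE : C⁻¹ * (θ ^ 4 * (S ^ 2 + V ^ 2 + Q ^ 2)) ≤ X ^ 2 + β / 2 * Y ^ 2 + S ^ 2 := by
    rw [inv_mul_le_iff₀ hC0]
    have h1 : θ ^ 4 * S ^ 2 ≤ Θ ^ 4 * S ^ 2 := by gcongr
    have h2 : θ ^ 4 * V ^ 2 ≤ Θ ^ 2 * X ^ 2 := by
      have : θ ^ 4 * V ^ 2 = θ ^ 2 * X ^ 2 := by rw [hX]; ring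
      rw [this]; gcongr
    have h3 : θ ^ 4 * Q ^ 2 = 2 / β * (β / 2 * Y ^ 2) := by rw [hY]; field_simp
    have g1 : Θ ^ 4 * S ^ 2 ≤ C * S ^ 2 := by gcongr; rw [hC]; linarith [sq_nonneg Θ, show 0 < 2 / β by positivity]
    have g2 : Θ ^ 2 * X ^ 2 ≤ C * X ^ 2 := by gcongr; rw [hC]; linarith [pow_pos hΘ0 4, show 0 < 2 / β by positivity]
    have g3 : 2 / β * (β / 2 * Y ^ 2) ≤ C * (β / 2 * Y ^ 2) := by gcongr; rw [hC]; linarith [pow_pos hΘ0 4, sq_nonneg Θ]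
    linarith
  linarith

/-- Observability of the adjoint modes through the first component, uniformly in the frequency. -/
lemma observability {T u α β κ : ℝ} (hT : 0 < T) (hu : 0 < u) (hα : 0 < α)
    (hβ : 0 < β) (hκ : 0 < κ) :
    ∃ c : ℝ, 0 < c ∧ ∀ k : ℝ, 1 ≤ |k| → ∀ σ v q : ℝ → ℂ,
      (∀ t, HasDerivAt σ (Complex.I * k * (u * σ t + α * v t)) t) →
      (∀ t, HasDerivAt v (Complex.I * k * (u * v t + α * σ t - β * q t)) t) →
      (∀ t, HasDerivAt q (-(κ⁻¹ : ℝ) * q t - Complex.I * k * (β * v t)) t) →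
      ∀ m : ℝ, (∀ t ∈ Set.Icc 0 T, m ≤ ‖σ t‖ ^ 2 + ‖v t‖ ^ 2 + ‖q t‖ ^ 2) →
        c * m ≤ ∫ t in (0 : ℝ)..T, ‖σ t‖ ^ 2 := by
  obtain ⟨L, K, c, hL, hK, hc, hF⟩ := multiplier_quadratic_bound hT hu hα hβ hκ
  have hI : 0 < ∫ t in (0 : ℝ)..T, (t * (T - t)) ^ 4 := by
    apply intervalIntegral.intervalIntegral_pos_of_pos_on _ _ hT
    · exact Continuous.intervalIntegrable (by fun_prop) _ _
    · intro t ht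
      have := ht.1
      have : 0 < T - t := by linarith [ht.2]
      positivity
  refine ⟨K⁻¹ * (c * ∫ t in (0 : ℝ)..T, (t * (T - t)) ^ 4), by positivity, ?_⟩
  intro k hk σ v q hσ hv hq m hm
  have hk0 : k ≠ 0 := by rintro rfl; norm_num at hk
  have cσ : Continuous σ := continuous_iff_continuousAt.2 fun t => (hσ t).continuousAt
  have conj_deriv : ∀ {f : ℝ → ℂ} {f' : ℂ} {t : ℝ}, HasDerivAt f f' t →
      HasDerivAt (fun s => conj (f s)) (conj f') t := fun h => h.star
  have im_deriv : ∀ {f : ℝ → ℂ} {f' : ℂ} {t : ℝ}, HasDerivAt f f' t →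
      HasDerivAt (fun s => (f s).im) f'.im t := fun h =>
    (Complex.imCLM.hasFDerivAt.comp_hasDerivAt _ h)
  -- The transport terms cancel in `P'` because `σ` and `v` move at the same speed `u`; in `R'` one
  -- remains, since `q` is not transported.
  obtain ⟨P, hPdef⟩ : ∃ P : ℝ → ℝ, P = fun t => k⁻¹ * (σ t * conj (v t)).im := ⟨_, rfl⟩
  obtain ⟨R, hRdef⟩ : ∃ R : ℝ → ℝ, R = fun t => k⁻¹ * (v t * conj (q t)).im := ⟨_, rfl⟩
  have hP : ∀ t, HasDerivAt P (α * (‖v t‖ ^ 2 - ‖σ t‖ ^ 2) + β * (σ t * conj (q t)).re) t := by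
    intro t
    rw [hPdef]
    refine ((im_deriv ((hσ t).mul (conj_deriv (hv t)))).const_mul k⁻¹).congr_deriv ?_
    rw [← Complex.normSq_eq_norm_sq, ← Complex.normSq_eq_norm_sq, inv_mul_eq_iff_eq_mul₀ hk0]
    simp [Complex.normSq_apply]
    ring
  have hR : ∀ t, HasDerivAt R (u * (v t * conj (q t)).re + α * (σ t * conj (q t)).re
      + β * (‖v t‖ ^ 2 - ‖q t‖ ^ 2) - κ⁻¹ * R t) t := by
    intro t
    rw [hRdef]
    refine ((im_deriv ((hv t).mul (conj_deriv (hq t)))).const_mul k⁻¹).congr_deriv ?_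
    rw [← Complex.normSq_eq_norm_sq, ← Complex.normSq_eq_norm_sq, inv_mul_eq_iff_eq_mul₀ hk0]
    simp [Complex.normSq_apply]
    field_simp
    ring
  have hkinv : |k⁻¹| ≤ 1 := by rw [abs_inv]; exact inv_le_one_of_one_le₀ hk
  have bound_im : ∀ x y : ℂ, |k⁻¹ * (x * conj y).im| ≤ ‖x‖ * ‖y‖ := fun x y => by
    rw [abs_mul]
    calc |k⁻¹| * |(x * conj y).im| ≤ 1 * ‖x * conj y‖ := by
          gcongr; exact Complex.abs_im_le_norm _
      _ = ‖x‖ * ‖y‖ := by simp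
  have bound_re : ∀ x y : ℂ, |(x * conj y).re| ≤ ‖x‖ * ‖y‖ := fun x y => by
    simpa using Complex.abs_re_le_norm (x * conj y)
  -- `F` vanishes at both ends and `F' ≤ K ‖σ‖² - c m (t (T - t))⁴`, so integrating over `[0, T]`
  -- gives the claim.
  obtain ⟨F, hFdef⟩ : ∃ F : ℝ → ℝ, F = fun t =>
    (t * (T - t)) ^ 4 * R t - L * ((t * (T - t)) ^ 2 * P t) := ⟨_, rfl⟩
  have hθ : ∀ t : ℝ, HasDerivAt (fun t => t * (T - t)) (T - 2 * t) t := fun t => by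
    refine ((hasDerivAt_id t).mul ((hasDerivAt_id t).const_sub T)).congr_deriv ?_
    simp; ring
  have hFd : ∀ t, HasDerivAt F (-(L * (2 * (t * (T - t)) * (T - 2 * t) * P t + (t * (T - t)) ^ 2 *
      (α * (‖v t‖ ^ 2 - ‖σ t‖ ^ 2) + β * (σ t * conj (q t)).re)) -
      (4 * (t * (T - t)) ^ 3 * (T - 2 * t) * R t + (t * (T - t)) ^ 4 *
      (u * (v t * conj (q t)).re + α * (σ t * conj (q t)).re
      + β * (‖v t‖ ^ 2 - ‖q t‖ ^ 2) - κ⁻¹ * R t)))) t := by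
    intro t
    rw [hFdef]
    refine ((((hθ t).pow 4).mul (hR t)).sub ((((hθ t).pow 2).mul (hP t)).const_mul L)).congr_deriv ?_
    simp
  have key := intervalIntegral.sub_le_integral_of_hasDeriv_right_of_le (a := 0) (b := T) (g := F)
    (φ := fun t => K * ‖σ t‖ ^ 2 - c * m * (t * (T - t)) ^ 4) hT.le
    (fun t _ => (hFd t).continuousAt.continuousWithinAt) (fun t _ => (hFd t).hasDerivWithinAt)
    ((Continuous.continuousOn (by fun_prop)).integrableOn_Icc) (by
      intro t ht
      have h0 : 0 ≤ t * (T - t) := mul_nonneg ht.1.le (by linarith [ht.2])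
      have h1 : t * (T - t) ≤ T ^ 2 := by nlinarith [ht.1, ht.2]
      have h2 : |T - 2 * t| ≤ T := abs_le.2 ⟨by linarith [ht.2], by linarith [ht.1]⟩
      have bP : |P t| ≤ ‖σ t‖ * ‖v t‖ := by rw [hPdef]; exact bound_im _ _
      have bR : |R t| ≤ ‖v t‖ * ‖q t‖ := by rw [hRdef]; exact bound_im _ _
      have := hF (t * (T - t)) (T - 2 * t) ‖σ t‖ ‖v t‖ ‖q t‖
        (α * (‖v t‖ ^ 2 - ‖σ t‖ ^ 2) + β * (σ t * conj (q t)).re)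
        (u * (v t * conj (q t)).re + α * (σ t * conj (q t)).re
          + β * (‖v t‖ ^ 2 - ‖q t‖ ^ 2) - κ⁻¹ * R t) (P t) (R t) h0 h1 h2 (norm_nonneg _)
        (norm_nonneg _) (norm_nonneg _) bP bR (by
          have := mul_le_mul_of_nonneg_left (neg_le_of_abs_le (bound_re (σ t) (q t))) hβ.le
          linarith) (by
          have g1 := mul_le_mul_of_nonneg_left (le_of_abs_le (bound_re (v t) (q t))) hu.le
          have g2 := mul_le_mul_of_nonneg_left (le_of_abs_le (bound_re (σ t) (q t))) hα.le
          have g3 := mul_le_mul_of_nonneg_left (neg_le_of_abs_le bR) (inv_nonneg.2 hκ.le)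
          linarith)
      have h3 : c * ((t * (T - t)) ^ 4 * m) ≤
          c * ((t * (T - t)) ^ 4 * (‖σ t‖ ^ 2 + ‖v t‖ ^ 2 + ‖q t‖ ^ 2)) := by
        have := hm t ⟨ht.1.le, ht.2.le⟩
        gcongr
      linarith)
  have hFT : F T - F 0 = 0 := by simp [hFdef]
  rw [hFT, intervalIntegral.integral_sub, intervalIntegral.integral_const_mul,
    intervalIntegral.integral_const_mul] at key
  · rw [mul_assoc, inv_mul_le_iff₀ hK]
    linarith
  · exact Continuous.intervalIntegrable (by fun_prop) _ _
  · exact Continuous.intervalIntegrable (by fun_prop) _ _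

end MaxwellNS

/-! ### Linear control in Hilbert space: flows, Gramian, duality -/

namespace MaxwellNS

open NormedSpace (exp)
open scoped InnerProductSpace

section LinearControl

variable {H : Type*} [NormedAddCommGroup H] [InnerProductSpace ℂ H] [CompleteSpace H]

lemma hasDerivAt_flow (A : H →L[ℂ] H) (x : H) (t : ℝ) :
    HasDerivAt (fun t : ℝ => exp (t • A) x) (A (exp (t • A) x)) t :=
  (((ContinuousLinearMap.apply ℂ H x).restrictScalars ℝ).hasFDerivAt.comp_hasDerivAt t
    (hasDerivAt_exp_smul_const' (𝕂 := ℝ) A t))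

lemma continuous_flow (A : H →L[ℂ] H) : Continuous fun t : ℝ => exp (t • A) :=
  continuous_iff_continuousAt.2 fun t => (hasDerivAt_exp_smul_const (𝕂 := ℝ) A t).continuousAt

lemma flow_add (A : H →L[ℂ] H) (s t : ℝ) : exp ((s + t) • A) = exp (s • A) * exp (t • A) := by
  let : NormedAlgebra ℚ (H →L[ℂ] H) := NormedAlgebra.restrictScalars ℚ ℂ _
  rw [add_smul]
  exact NormedSpace.exp_add_of_commute (((Commute.refl A).smul_left s).smul_right t)

lemma hasDerivAt_norm_sq_flow (A : H →L[ℂ] H) (x : H) (t : ℝ) :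
    HasDerivAt (fun t : ℝ => ‖exp (t • A) x‖ ^ 2)
      (2 * (⟪exp (t • A) x, A (exp (t • A) x)⟫_ℂ).re) t := by
  let : InnerProductSpace ℝ H := InnerProductSpace.rclikeToReal ℂ H
  exact (hasDerivAt_flow A x t).norm_sq

/-- The flow of a dissipative operator is a contraction. -/
lemma norm_flow_le_one {A : H →L[ℂ] H} (hA : ∀ x, (⟪x, A x⟫_ℂ).re ≤ 0) {t : ℝ} (ht : 0 ≤ t) :
    ‖exp (t • A)‖ ≤ 1 := by
  refine ContinuousLinearMap.opNorm_le_bound _ zero_le_one fun x => ?_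
  have h : Antitone fun t : ℝ => ‖exp (t • A) x‖ ^ 2 :=
    antitone_of_hasDerivAt_nonpos (hasDerivAt_norm_sq_flow A x) fun s => by
      simpa using mul_nonpos_of_nonneg_of_nonpos zero_le_two (hA _)
  have := h ht
  simp only [zero_smul, NormedSpace.exp_zero, one_apply_eq_self] at this
  rw [one_mul]
  exact le_of_sq_le_sq this (norm_nonneg _)

/-- The energy is lost at relative rate at most `2 d`, so `exp (2 d t)` times the energy is
nondecreasing. This supplies the lower bound `m` that `observability` asks for. -/
lemma exp_mul_norm_sq_le_norm_sq_flow {A : H →L[ℂ] H} {d : ℝ}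
    (hA : ∀ x, -(d * ‖x‖ ^ 2) ≤ (⟪x, A x⟫_ℂ).re) {t : ℝ} (ht : 0 ≤ t) (x : H) :
    Real.exp (-(2 * d * t)) * ‖x‖ ^ 2 ≤ ‖exp (t • A) x‖ ^ 2 := by
  have h : Monotone fun t : ℝ => Real.exp (2 * d * t) * ‖exp (t • A) x‖ ^ 2 := by
    refine monotone_of_hasDerivAt_nonneg (fun s => (((hasDerivAt_id s).const_mul
      (2 * d)).exp).mul (hasDerivAt_norm_sq_flow A x s)) fun s => ?_
    have := mul_nonneg (Real.exp_pos (2 * d * s)).le (sub_nonneg.2 (hA (exp (s • A) x)))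
    simp only [id, mul_one, Pi.zero_apply]
    linarith
  have := h ht
  simp only [zero_smul, NormedSpace.exp_zero, one_apply_eq_self, mul_zero,
    Real.exp_zero, one_mul] at this
  rw [Real.exp_neg, inv_mul_le_iff₀ (Real.exp_pos _)]
  exact this

lemma star_flow (A : H →L[ℂ] H) (t : ℝ) :
    ContinuousLinearMap.adjoint (exp (t • A)) = exp (t • ContinuousLinearMap.adjoint A) := by
  rw [← ContinuousLinearMap.star_eq_adjoint, ← ContinuousLinearMap.star_eq_adjoint,
    NormedSpace.star_exp]
  simp

/-- The controllability Gramian of the pair `(A, b)` on `[0, T]`. -/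
def gramian (A : H →L[ℂ] H) (b : H) (T : ℝ) : H →ₗ[ℂ] H where
  toFun y := ∫ s in (0 : ℝ)..T,
    ⟪b, exp ((T - s) • ContinuousLinearMap.adjoint A) y⟫_ℂ • exp ((T - s) • A) b
  map_add' x y := by
    rw [← intervalIntegral.integral_add]
    · simp [add_smul]
    all_goals
      refine Continuous.intervalIntegrable ?_ _ _
      have h1 : Continuous fun s => exp ((T - s) • A) :=
        (continuous_flow A).comp (continuous_const.sub continuous_id)
      have h2 : Continuous fun s => exp ((T - s) • ContinuousLinearMap.adjoint A) :=
        (continuous_flow _).comp (continuous_const.sub continuous_id)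
      fun_prop
  map_smul' c y := by
    rw [RingHom.id_apply, ← intervalIntegral.integral_smul]
    simp [mul_smul]

/-- Moving one flow across the inner product and reversing time turns the quadratic form of the
Gramian into the observed energy, so observability is coercivity. -/
lemma inner_gramian (A : H →L[ℂ] H) (b : H) (T : ℝ) (y : H) :
    ⟪y, gramian A b T y⟫_ℂ = ((∫ s in (0 : ℝ)..T,
      ‖⟪b, exp (s • ContinuousLinearMap.adjoint A) y⟫_ℂ‖ ^ 2 : ℝ) : ℂ) := by
  have h1 : Continuous fun s => exp ((T - s) • A) :=
    (continuous_flow A).comp (continuous_const.sub continuous_id)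
  have h2 : Continuous fun s => exp ((T - s) • ContinuousLinearMap.adjoint A) :=
    (continuous_flow _).comp (continuous_const.sub continuous_id)
  have h3 := (innerSL ℂ y).intervalIntegral_comp_comm (μ := volume) (a := 0) (b := T)
    (f := fun s => ⟪b, exp ((T - s) • ContinuousLinearMap.adjoint A) y⟫_ℂ • exp ((T - s) • A) b)
    (Continuous.intervalIntegrable (by fun_prop) _ _)
  simp only [innerSL_apply_apply] at h3
  change ⟪y, ∫ s in (0 : ℝ)..T, _⟫_ℂ = _
  have h4 := intervalIntegral.integral_comp_sub_left (a := 0) (b := T) (fun s =>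
    ((‖⟪b, exp (s • ContinuousLinearMap.adjoint A) y⟫_ℂ‖ ^ 2 : ℝ) : ℂ)) T
  rw [sub_self, sub_zero] at h4
  rw [← h3, ← intervalIntegral.integral_ofReal, ← h4]
  refine intervalIntegral.integral_congr fun s _ => ?_
  rw [inner_smul_right, ← star_flow, ContinuousLinearMap.adjoint_inner_right,
    ← inner_conj_symm y, RCLike.mul_conj]
  simp

/-- Controllability of a linear system with a scalar control from an observability inequality, with
explicit bounds. -/
lemma exists_control_of_observable [FiniteDimensional ℂ H] {A : H →L[ℂ] H} {b : H} {T c : ℝ}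
    (hT : 0 < T) (hc : 0 < c) (hA : ∀ t : ℝ, 0 ≤ t → ‖exp (t • A)‖ ≤ 1)
    (hobs : ∀ y, c * ‖y‖ ^ 2 ≤ ∫ s in (0 : ℝ)..T,
      ‖⟪b, exp (s • ContinuousLinearMap.adjoint A) y⟫_ℂ‖ ^ 2) (z₀ z₁ : H) :
    ∃ (f : ℝ → ℂ) (z : ℝ → H), Continuous f ∧
      (∀ t, HasDerivAt z (A (z t) + f t • b) t) ∧ z 0 = z₀ ∧ z T = z₁ ∧
      ∀ t ∈ Set.Icc 0 T, ‖f t‖ ≤ ‖b‖ * (c⁻¹ * (‖z₀‖ + ‖z₁‖)) ∧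
        ‖z t‖ ≤ (1 + ‖b‖ * (‖b‖ * c⁻¹) * T) * (‖z₀‖ + ‖z₁‖) := by
  have hlow : ∀ y, ‖y‖ ≤ c⁻¹ * ‖gramian A b T y‖ := fun y => by
    rw [le_inv_mul_iff₀ hc]
    rcases (norm_nonneg y).eq_or_lt with h | h
    · rw [← h]; simp
    · have h1 : c * ‖y‖ ^ 2 ≤ ‖y‖ * ‖gramian A b T y‖ := by
        refine (hobs y).trans (le_trans ?_ (norm_inner_le_norm (𝕜 := ℂ) y (gramian A b T y)))
        rw [inner_gramian, Complex.norm_real]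
        exact le_abs_self _
      refine le_of_mul_le_mul_left ?_ h
      linarith
  have hinj : Function.Injective (gramian A b T) := by
    rw [← LinearMap.ker_eq_bot, LinearMap.ker_eq_bot']
    intro y hy
    have := hlow y
    rw [hy, norm_zero, mul_zero] at this
    exact norm_le_zero_iff.1 this
  -- `y` is the adjoint datum whose observation, run backwards from `T`, is the control.
  obtain ⟨y, hy⟩ := LinearMap.injective_iff_surjective.1 hinj (z₁ - exp (T • A) z₀)
  have hyn : ‖y‖ ≤ c⁻¹ * (‖z₀‖ + ‖z₁‖) := by
    refine (hlow y).trans ?_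
    rw [hy]
    gcongr
    refine (norm_sub_le _ _).trans ?_
    have : ‖exp (T • A) z₀‖ ≤ 1 * ‖z₀‖ := ContinuousLinearMap.le_of_opNorm_le _ (hA T hT.le) _
    linarith
  obtain ⟨f, hf⟩ : ∃ f : ℝ → ℂ,
    f = fun s => ⟪b, exp ((T - s) • ContinuousLinearMap.adjoint A) y⟫_ℂ := ⟨_, rfl⟩
  have hfc : Continuous f := by
    have h2 : Continuous fun s => exp ((T - s) • ContinuousLinearMap.adjoint A) :=
      (continuous_flow _).comp (continuous_const.sub continuous_id)
    rw [hf]; fun_prop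
  have hfb : ∀ t ∈ Set.Icc 0 T, ‖f t‖ ≤ ‖b‖ * (c⁻¹ * (‖z₀‖ + ‖z₁‖)) := fun t ht => by
    rw [hf]
    refine (norm_inner_le_norm (𝕜 := ℂ) _ _).trans ?_
    gcongr
    refine le_trans ?_ hyn
    have h1 : ‖exp ((T - t) • ContinuousLinearMap.adjoint A)‖ ≤ 1 := by
      rw [← star_flow, LinearIsometryEquiv.norm_map]
      exact hA _ (by linarith [ht.2])
    simpa using ContinuousLinearMap.le_of_opNorm_le _ h1 y
  have hgc : Continuous fun s : ℝ => f s • exp ((-s) • A) b := by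
    have h2 : Continuous fun s : ℝ => exp ((-s) • A) := (continuous_flow A).comp continuous_neg
    fun_prop
  obtain ⟨z, hz⟩ : ∃ z : ℝ → H, z = fun t =>
    exp (t • A) (z₀ + ∫ s in (0 : ℝ)..t, f s • exp ((-s) • A) b) := ⟨_, rfl⟩
  -- The defining form of `z` is easy to differentiate; this Duhamel form is the one to estimate,
  -- because only flows at nonnegative times are contractions.
  have hduh : ∀ t, z t = exp (t • A) z₀ + ∫ s in (0 : ℝ)..t, f s • exp ((t - s) • A) b := by
    intro t
    rw [hz]
    simp only [map_add]
    congr 1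
    rw [← ContinuousLinearMap.intervalIntegral_comp_comm _ (hgc.intervalIntegrable _ _)]
    refine intervalIntegral.integral_congr fun s _ => ?_
    simp only [map_smul, sub_eq_add_neg t s, flow_add]
    rfl
  refine ⟨f, z, hfc, ?_, by simp [hz], ?_, fun t ht => ⟨hfb t ht, ?_⟩⟩
  · intro t
    have h0 : HasDerivAt (fun t : ℝ => (exp (t • A)).restrictScalars ℝ)
        ((A * exp (t • A)).restrictScalars ℝ) t :=
      (ContinuousLinearMap.restrictScalarsL ℂ H H ℝ ℝ).hasFDerivAt.comp_hasDerivAt t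
        (hasDerivAt_exp_smul_const' (𝕂 := ℝ) A t)
    have h1 := h0.clm_apply
      ((intervalIntegral.integral_hasDerivAt_right (hgc.intervalIntegrable 0 t)
        hgc.aestronglyMeasurable.stronglyMeasurableAtFilter hgc.continuousAt).const_add z₀)
    rw [hz]
    refine h1.congr_deriv ?_
    have h2 : exp (t • A) (exp ((-t) • A) b) = b := by
      have := flow_add A t (-t)
      simp only [add_neg_cancel, zero_smul, NormedSpace.exp_zero] at this
      exact (congrArg (fun B : H →L[ℂ] H => B b) this).symm
    simp only [ContinuousLinearMap.coe_restrictScalars', map_smul, h2]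
    rfl
  · rw [hduh, hf]
    have : gramian A b T y = ∫ s in (0 : ℝ)..T,
      ⟪b, exp ((T - s) • ContinuousLinearMap.adjoint A) y⟫_ℂ • exp ((T - s) • A) b := rfl
    rw [← this, hy]
    abel
  · rw [hduh]
    have h1 : ‖exp (t • A) z₀‖ ≤ 1 * ‖z₀‖ :=
      ContinuousLinearMap.le_of_opNorm_le _ (hA t ht.1) _
    have h2 : ‖∫ s in (0 : ℝ)..t, f s • exp ((t - s) • A) b‖ ≤
        ‖b‖ * (c⁻¹ * (‖z₀‖ + ‖z₁‖)) * ‖b‖ * |t - 0| := by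
      refine intervalIntegral.norm_integral_le_of_norm_le_const fun s hs => ?_
      rw [Set.uIoc_of_le ht.1] at hs
      rw [norm_smul]
      gcongr
      · exact hfb s ⟨hs.1.le, hs.2.trans ht.2⟩
      · simpa using ContinuousLinearMap.le_of_opNorm_le _ (hA (t - s) (by linarith [hs.2])) b
    rw [sub_zero, abs_of_nonneg ht.1] at h2
    have h3 : ‖b‖ * (c⁻¹ * (‖z₀‖ + ‖z₁‖)) * ‖b‖ * t ≤
        ‖b‖ * (c⁻¹ * (‖z₀‖ + ‖z₁‖)) * ‖b‖ * T := by
      have := ht.2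
      gcongr
    refine (norm_add_le _ _).trans ?_
    have := norm_nonneg z₁
    linarith

end LinearControl

end MaxwellNS

/-! ### Fourier modes: symmetrised generator and uniform control -/

namespace MaxwellNS

open NormedSpace (exp)
open scoped InnerProductSpace
open ComplexConjugate Complex

/-- The generator of the Fourier mode of frequency `k` in symmetrised variables. -/
def modeMatrix (k u α β κ : ℝ) : Matrix (Fin 3) (Fin 3) ℂ :=
  !![-(I * k * u), -(I * k * α), 0; -(I * k * α), -(I * k * u), I * k * β;
    0, I * k * β, -(κ⁻¹ : ℝ)]

/-- The generator of the Fourier mode of frequency `k`, as an operator on `ℂ³`. -/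
def modeOperator (k u α β κ : ℝ) :
    EuclideanSpace ℂ (Fin 3) →L[ℂ] EuclideanSpace ℂ (Fin 3) :=
  Matrix.toEuclideanCLM (𝕜 := ℂ) (modeMatrix k u α β κ)

lemma modeOperator_apply (k u α β κ : ℝ) (x : EuclideanSpace ℂ (Fin 3)) :
    modeOperator k u α β κ x = !₂[-(I * k * u) * x 0 - I * k * α * x 1,
      -(I * k * α) * x 0 - I * k * u * x 1 + I * k * β * x 2,
      I * k * β * x 1 - (κ⁻¹ : ℝ) * x 2] := by
  ext i
  fin_cases i <;>
    simp [modeOperator, modeMatrix, Matrix.mulVec, dotProduct, Fin.sum_univ_three] <;> ring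

/-- The entries are arranged as the right-hand sides in `observability`, with `σ, v, q` the
coordinates of the adjoint flow. -/
lemma adjoint_modeOperator_apply (k u α β κ : ℝ) (x : EuclideanSpace ℂ (Fin 3)) :
    ContinuousLinearMap.adjoint (modeOperator k u α β κ) x =
      !₂[I * k * (u * x 0 + α * x 1), I * k * (u * x 1 + α * x 0 - β * x 2),
        -(κ⁻¹ : ℝ) * x 2 - I * k * (β * x 1)] := by
  rw [← ContinuousLinearMap.star_eq_adjoint, modeOperator, ← map_star, Matrix.star_eq_conjTranspose]
  ext i
  fin_cases i <;>
    simp [modeMatrix, Matrix.mulVec, dotProduct, Fin.sum_univ_three,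
      Matrix.conjTranspose_apply] <;> ring

/-- Transport and coupling form a skew-Hermitian matrix, so only the relaxation term contributes. -/
lemma re_inner_modeOperator (k u α β κ : ℝ) (x : EuclideanSpace ℂ (Fin 3)) :
    (⟪x, modeOperator k u α β κ x⟫_ℂ).re = -(κ⁻¹ * ‖x 2‖ ^ 2) := by
  rw [modeOperator_apply, PiLp.inner_apply, ← Complex.normSq_eq_norm_sq]
  simp [Fin.sum_univ_three, Complex.normSq_apply]
  ring

lemma norm_sq_eq_three (x : EuclideanSpace ℂ (Fin 3)) :
    ‖x‖ ^ 2 = ‖x 0‖ ^ 2 + ‖x 1‖ ^ 2 + ‖x 2‖ ^ 2 := by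
  rw [EuclideanSpace.norm_sq_eq, Fin.sum_univ_three]

lemma norm_le_sum_three (x : EuclideanSpace ℂ (Fin 3)) :
    ‖x‖ ≤ ‖x 0‖ + ‖x 1‖ + ‖x 2‖ := by
  refine le_of_sq_le_sq ?_ (by positivity)
  rw [norm_sq_eq_three]
  have h0 := norm_nonneg (x 0)
  have h1 := norm_nonneg (x 1)
  have h2 := norm_nonneg (x 2)
  linarith [mul_nonneg h0 h1, mul_nonneg h0 h2, mul_nonneg h1 h2]

lemma re_inner_adjoint_modeOperator (k u α β κ : ℝ) (x : EuclideanSpace ℂ (Fin 3)) :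
    (⟪x, ContinuousLinearMap.adjoint (modeOperator k u α β κ) x⟫_ℂ).re = -(κ⁻¹ * ‖x 2‖ ^ 2) := by
  rw [ContinuousLinearMap.adjoint_inner_right, ← inner_conj_symm, conj_re, re_inner_modeOperator]

lemma hasDerivAt_coord {z : ℝ → EuclideanSpace ℂ (Fin 3)} {z' : EuclideanSpace ℂ (Fin 3)} {t : ℝ}
    (h : HasDerivAt z z' t) (i : Fin 3) : HasDerivAt (fun t => z t i) (z' i) t :=
  ((EuclideanSpace.proj (𝕜 := ℂ) i).restrictScalars ℝ).hasFDerivAt.comp_hasDerivAt t h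

/-- Uniform controllability of the nonconstant Fourier modes in symmetrised variables. -/
lemma exists_control_modeOperator {T u α β κ : ℝ} (hT : 0 < T) (hu : 0 < u) (hα : 0 < α)
    (hβ : 0 < β) (hκ : 0 < κ) :
    ∃ C : ℝ, 0 < C ∧ ∀ k : ℝ, 1 ≤ |k| → ∀ z₀ z₁ : EuclideanSpace ℂ (Fin 3),
      ∃ (f : ℝ → ℂ) (z : ℝ → EuclideanSpace ℂ (Fin 3)), Continuous f ∧
        (∀ t, HasDerivAt z (modeOperator k u α β κ (z t) + f t • EuclideanSpace.single 0 1) t) ∧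
        z 0 = z₀ ∧ z T = z₁ ∧
        ∀ t ∈ Set.Icc 0 T, ‖f t‖ ≤ C * (‖z₀‖ + ‖z₁‖) ∧ ‖z t‖ ≤ C * (‖z₀‖ + ‖z₁‖) := by
  obtain ⟨c, hc, hobs⟩ := observability hT hu hα hβ hκ
  -- The exponential is the least fraction of its initial energy that an adjoint mode can retain on
  -- `[0, T]`.
  obtain ⟨d, hd⟩ : ∃ d, d = c * Real.exp (-(2 * κ⁻¹ * T)) := ⟨_, rfl⟩
  have hd0 : 0 < d := by rw [hd]; positivity
  refine ⟨1 + d⁻¹ + d⁻¹ * T, by positivity, fun k hk z₀ z₁ => ?_⟩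
  obtain ⟨f, z, hf, hz, h0, h1, hb⟩ := exists_control_of_observable (H := EuclideanSpace ℂ (Fin 3))
    (A := modeOperator k u α β κ) (b := EuclideanSpace.single 0 1) hT hd0
    (fun t ht => norm_flow_le_one (fun x => by
      rw [re_inner_modeOperator, neg_nonpos]; positivity) ht) (fun y => by
      have hode := fun t : ℝ =>
        hasDerivAt_flow (ContinuousLinearMap.adjoint (modeOperator k u α β κ)) y t
      simp only [adjoint_modeOperator_apply] at hode
      have := hobs k hk _ _ _ (fun t => hasDerivAt_coord (hode t) 0)
        (fun t => hasDerivAt_coord (hode t) 1) (fun t => hasDerivAt_coord (hode t) 2)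
        (Real.exp (-(2 * κ⁻¹ * T)) * ‖y‖ ^ 2) (fun t ht => by
          rw [← norm_sq_eq_three]
          refine le_trans ?_ (exp_mul_norm_sq_le_norm_sq_flow (d := κ⁻¹) (fun x => ?_) ht.1 y)
          · have := ht.2
            gcongr
          · rw [re_inner_adjoint_modeOperator, norm_sq_eq_three]
            gcongr
            linarith [sq_nonneg ‖x 0‖, sq_nonneg ‖x 1‖])
      rw [hd, mul_assoc]
      simpa [EuclideanSpace.inner_single_left] using this) z₀ z₁
  refine ⟨f, z, hf, hz, h0, h1, fun t ht => ⟨(hb t ht).1.trans ?_, (hb t ht).2.trans ?_⟩⟩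
  · simp only [PiLp.norm_single, norm_one, one_mul]
    gcongr
    have : 0 < d⁻¹ * T := by positivity
    linarith
  · simp only [PiLp.norm_single, norm_one, one_mul]
    gcongr
    have : 0 < d⁻¹ := by positivity
    linarith

/-! ### Return to the physical variables -/

lemma Params.Admissible.b_pos {p : Params} (hp : p.Admissible) : 0 < p.b :=
  mul_pos (mul_pos hp.a_pos (zero_lt_one.trans_le hp.one_le_γ)) (Real.rpow_pos_of_pos hp.ρs_pos _)

/-- Uniform controllability of the Fourier modes of the linearised system. -/
lemma exists_mode_control {p : Params} (hp : p.Admissible) {T : ℝ} (hT : 0 < T) :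
    ∃ C : ℝ, 0 < C ∧ ∀ (n : ℤ) (r₀ v₀ s₀ r₁ v₁ s₁ : ℂ),
      (n = 0 → v₀ = 0 ∧ s₀ = 0 ∧ v₁ = 0 ∧ s₁ = 0) →
      ∃ f r v s : ℝ → ℂ, Continuous f ∧
        (∀ t, HasDerivAt r (-(I * n) * (p.us * r t + p.ρs * v t) + f t) t) ∧
        (∀ t, HasDerivAt v (-(I * n) * (p.us * v t + p.b * r t - (1 / p.ρs : ℂ) * s t)) t) ∧
        (∀ t, HasDerivAt s (-(1 / p.κ : ℂ) * s t + I * n * ((p.μ / p.κ : ℂ) * v t)) t) ∧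
        r 0 = r₀ ∧ v 0 = v₀ ∧ s 0 = s₀ ∧ r T = r₁ ∧ v T = v₁ ∧ s T = s₁ ∧
        ∀ t ∈ Set.Icc 0 T,
          ‖f t‖ ≤ C * (‖r₀‖ + ‖v₀‖ + ‖s₀‖ + ‖r₁‖ + ‖v₁‖ + ‖s₁‖) ∧
          ‖r t‖ ≤ C * (‖r₀‖ + ‖v₀‖ + ‖s₀‖ + ‖r₁‖ + ‖v₁‖ + ‖s₁‖) ∧
          ‖v t‖ ≤ C * (‖r₀‖ + ‖v₀‖ + ‖s₀‖ + ‖r₁‖ + ‖v₁‖ + ‖s₁‖) ∧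
          ‖s t‖ ≤ C * (‖r₀‖ + ‖v₀‖ + ‖s₀‖ + ‖r₁‖ + ‖v₁‖ + ‖s₁‖) := by
  have hb := hp.b_pos
  have hρ := hp.ρs_pos
  have hμ := hp.μ_pos
  have hκ := hp.κ_pos
  -- In the variables `(x r, v, y s)` both couplings become symmetric, with `α = ρs x` and `β = (μ /
  -- κ) y`.
  obtain ⟨x, hx⟩ : ∃ x, x = √(p.b / p.ρs) := ⟨_, rfl⟩
  obtain ⟨y, hy⟩ : ∃ y, y = √(p.κ / (p.ρs * p.μ)) := ⟨_, rfl⟩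
  have hx0 : 0 < x := by rw [hx]; positivity
  have hy0 : 0 < y := by rw [hy]; positivity
  have hx2 : p.b = p.ρs * x ^ 2 := by
    rw [hx, Real.sq_sqrt (by positivity)]; field_simp
  have hy2 : 1 / p.ρs = p.μ / p.κ * y ^ 2 := by
    rw [hy, Real.sq_sqrt (by positivity)]; field_simp
  obtain ⟨C, hC, H⟩ := exists_control_modeOperator hT hp.us_pos
    (show 0 < p.ρs * x by positivity) (show 0 < p.μ / p.κ * y by positivity) hκ
  obtain ⟨m, hm⟩ : ∃ m, m = 1 + x + y := ⟨_, rfl⟩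
  have hm0 : 0 < m := by rw [hm]; positivity
  obtain ⟨l, hl⟩ : ∃ l, l = 1 + x⁻¹ + y⁻¹ := ⟨_, rfl⟩
  have hl0 : 0 < l := by rw [hl]; positivity
  -- `m` and `l` bound the change of variables and its inverse for `n ≠ 0`; `T⁻¹ + 1` serves the
  -- mode `n = 0`, where the density is interpolated linearly.
  refine ⟨l * (C * m) + T⁻¹ + 1, by positivity, fun n r₀ v₀ s₀ r₁ v₁ s₁ hn => ?_⟩
  obtain ⟨N, hN⟩ : ∃ N, N = ‖r₀‖ + ‖v₀‖ + ‖s₀‖ + ‖r₁‖ + ‖v₁‖ + ‖s₁‖ := ⟨_, rfl⟩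
  rw [← hN]
  have hN0 : 0 ≤ N := by rw [hN]; positivity
  rcases eq_or_ne n 0 with rfl | hn0
  · obtain ⟨rfl, rfl, rfl, rfl⟩ := hn rfl
    have hT' : (T : ℂ) ≠ 0 := by exact_mod_cast hT.ne'
    have hN' : N = ‖r₀‖ + ‖r₁‖ := by rw [hN]; simp
    have hCN : (1 + T⁻¹) * N ≤ (l * (C * m) + T⁻¹ + 1) * N := by
      refine mul_le_mul_of_nonneg_right ?_ hN0
      have : 0 < l * (C * m) := by positivity
      linarith
    have hTN : 0 ≤ T⁻¹ * N := by positivity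
    have hsub : ‖r₁ - r₀‖ ≤ N := by rw [hN', add_comm]; exact norm_sub_le _ _
    refine ⟨fun _ => (r₁ - r₀) / T, fun t => (1 - t / T : ℝ) * r₀ + (t / T : ℝ) * r₁, 0, 0,
      continuous_const, fun t => ?_, fun t => ?_, fun t => ?_, by simp, rfl, rfl, ?_, rfl, rfl,
      fun t ht => ⟨?_, ?_, ?_, ?_⟩⟩
    · have h1 := ((((hasDerivAt_id t).div_const T).const_sub 1).ofReal_comp.mul_const r₀).add
        (((hasDerivAt_id t).div_const T).ofReal_comp.mul_const r₁)
      refine h1.congr_deriv ?_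
      push_cast
      simp
      field_simp
      ring
    · simp
    · simp
    · simp [hT.ne']
    · rw [norm_div, Complex.norm_real, Real.norm_of_nonneg hT.le, div_eq_inv_mul]
      refine le_trans ?_ hCN
      have : T⁻¹ * ‖r₁ - r₀‖ ≤ T⁻¹ * N := by gcongr
      linarith
    · have h0 : 0 ≤ t / T := div_nonneg ht.1 hT.le
      have h1 : t / T ≤ 1 := div_le_one_of_le₀ ht.2 hT.le
      refine le_trans ?_ hCN
      refine (norm_add_le _ _).trans ?_
      rw [norm_mul, norm_mul, Complex.norm_real, Complex.norm_real, Real.norm_of_nonneg h0,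
        Real.norm_of_nonneg (sub_nonneg.2 h1)]
      have g1 : (1 - t / T) * ‖r₀‖ ≤ 1 * ‖r₀‖ := by gcongr; linarith
      have g2 : t / T * ‖r₁‖ ≤ 1 * ‖r₁‖ := by gcongr
      linarith
    · simp; positivity
    · simp; positivity
  · have hn1 : 1 ≤ |(n : ℝ)| := by exact_mod_cast Int.one_le_abs hn0
    obtain ⟨f, z, hf, hz, h0, h1, hb⟩ := H n hn1 !₂[x * r₀, v₀, y * s₀] !₂[x * r₁, v₁, y * s₁]
    have hxc : (x : ℂ) ≠ 0 := by exact_mod_cast hx0.ne'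
    have hyc : (y : ℂ) ≠ 0 := by exact_mod_cast hy0.ne'
    have hx2c : (p.b : ℂ) = p.ρs * x ^ 2 := by exact_mod_cast congrArg ((↑) : ℝ → ℂ) hx2
    have hy2c : (1 / p.ρs : ℂ) = p.μ / p.κ * y ^ 2 := by
      exact_mod_cast congrArg ((↑) : ℝ → ℂ) hy2
    have hvec : ∀ r v s : ℂ, ‖(!₂[x * r, v, y * s] : EuclideanSpace ℂ (Fin 3))‖ ≤
        m * (‖r‖ + ‖v‖ + ‖s‖) := fun r v s => by
      refine (norm_le_sum_three _).trans ?_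
      simp only [Matrix.cons_val_zero, Matrix.cons_val_one, Matrix.cons_val,
        norm_mul, Complex.norm_real, Real.norm_of_nonneg hx0.le, Real.norm_of_nonneg hy0.le]
      have g1 : x * ‖r‖ ≤ m * ‖r‖ := by gcongr; linarith
      have g2 : 1 * ‖v‖ ≤ m * ‖v‖ := by gcongr; linarith
      have g3 : y * ‖s‖ ≤ m * ‖s‖ := by gcongr; linarith
      linarith
    have hvec2 : ‖(!₂[x * r₀, v₀, y * s₀] : EuclideanSpace ℂ (Fin 3))‖ +
        ‖(!₂[x * r₁, v₁, y * s₁] : EuclideanSpace ℂ (Fin 3))‖ ≤ m * N := by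
      rw [hN]
      linarith [hvec r₀ v₀ s₀, hvec r₁ v₁ s₁]
    have hscale : ∀ (w : ℂ) (a : ℝ), 0 ≤ a → a ≤ l → ‖w‖ ≤ C * (m * N) →
        ‖w * (a : ℂ)‖ ≤ (l * (C * m) + T⁻¹ + 1) * N := fun w a ha hal hw => by
      rw [norm_mul, Complex.norm_real, Real.norm_of_nonneg ha]
      calc ‖w‖ * a ≤ C * (m * N) * l := by gcongr
        _ = l * (C * m) * N := by ring
        _ ≤ _ := by
          gcongr
          have : 0 < T⁻¹ := by positivity
          linarith
    have hxl : x⁻¹ ≤ l := by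
      have : 0 < y⁻¹ := by positivity
      linarith
    have hyl : y⁻¹ ≤ l := by
      have : 0 < x⁻¹ := by positivity
      linarith
    have h1l : 1 ≤ l := by
      have : 0 < x⁻¹ := by positivity
      have : 0 < y⁻¹ := by positivity
      linarith
    have hzb : ∀ t ∈ Set.Icc 0 T, ∀ i, ‖z t i‖ ≤ C * (m * N) := fun t ht i =>
      (PiLp.norm_apply_le (z t) i).trans ((hb t ht).2.trans (by gcongr))
    have hfb : ∀ t ∈ Set.Icc 0 T, ‖f t‖ ≤ C * (m * N) := fun t ht =>
      (hb t ht).1.trans (by gcongr)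
    simp only [modeOperator_apply] at hz
    refine ⟨fun t => f t * (x⁻¹ : ℝ), fun t => z t 0 * (x⁻¹ : ℝ), fun t => z t 1,
      fun t => z t 2 * (y⁻¹ : ℝ), hf.mul continuous_const, fun t => ?_, fun t => ?_, fun t => ?_,
      ?_, ?_, ?_, ?_, ?_, ?_, fun t ht => ⟨?_, ?_, ?_, ?_⟩⟩
    · refine ((hasDerivAt_coord (hz t) 0).mul_const ((x⁻¹ : ℝ) : ℂ)).congr_deriv ?_
      simp
      field_simp
      ring
    · refine (hasDerivAt_coord (hz t) 1).congr_deriv ?_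
      rw [hx2c, hy2c]
      simp
      field_simp
      ring
    · refine ((hasDerivAt_coord (hz t) 2).mul_const ((y⁻¹ : ℝ) : ℂ)).congr_deriv ?_
      simp
      field_simp
      ring
    · simp [h0]; field_simp
    · simp [h0]
    · simp [h0]; field_simp
    · simp [h1]; field_simp
    · simp [h1]
    · simp [h1]; field_simp
    · exact hscale _ _ (by positivity) hxl (hfb t ht)
    · exact hscale _ _ (by positivity) hxl (hzb t ht 0)
    · simpa using hscale _ 1 zero_le_one h1l (hzb t ht 1)
    · exact hscale _ _ (by positivity) hyl (hzb t ht 2)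

end MaxwellNS

/-! ### Fourier analysis in `L²(0, 2π)` -/

namespace MaxwellNS

open scoped InnerProductSpace ENNReal
open ComplexConjugate Complex

lemma memLp_restrict_Ioo_of_continuous {E : Type*} [NormedAddCommGroup E]
    {f : ℝ → E} (hf : Continuous f) (a b : ℝ) (p : ℝ≥0∞) :
    MemLp f p (volume.restrict (Set.Ioo a b)) := by
  obtain ⟨C, hC⟩ := isCompact_Icc.exists_bound_of_continuousOn (s := Set.Icc a b) hf.continuousOn
  refine MemLp.of_bound hf.aestronglyMeasurable C ?_
  filter_upwards [ae_restrict_mem measurableSet_Ioo] with x hx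
  exact hC x ⟨hx.1.le, hx.2.le⟩

lemma integral_spaceMeasure (f : ℝ → ℂ) :
    ∫ x, f x ∂spaceMeasure = ∫ x in (0 : ℝ)..(2 * Real.pi), f x := by
  rw [intervalIntegral.integral_of_le Real.two_pi_pos.le, integral_Ioc_eq_integral_Ioo]

/-- The element of `L²` representing the pairing with a continuous function. -/
def testVector (φ : ℝ → ℂ) (hφ : Continuous φ) : L2 :=
  (memLp_restrict_Ioo_of_continuous (f := fun x => conj (φ x)) (by fun_prop) _ _ 2).toLp _

lemma coeFn_testVector (φ : ℝ → ℂ) (hφ : Continuous φ) :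
    testVector φ hφ =ᵐ[spaceMeasure] fun x => conj (φ x) :=
  MemLp.coeFn_toLp _

/-- The conjugate in `testVector` undoes that of the inner product, since `pair` is bilinear. -/
lemma pair_eq_inner (g : L2) {φ : ℝ → ℂ} (hφ : Continuous φ) :
    pair g φ = ⟪testVector φ hφ, g⟫_ℂ := by
  rw [L2.inner_def, pair]
  refine integral_congr_ae ?_
  filter_upwards [coeFn_testVector φ hφ] with x hx
  rw [hx, RCLike.inner_apply, conj_conj]

lemma pair_add_left (g h : L2) {φ : ℝ → ℂ} (hφ : Continuous φ) :
    pair (g + h) φ = pair g φ + pair h φ := by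
  simp only [pair_eq_inner _ hφ, inner_add_right]

lemma pair_sub_left (g h : L2) {φ : ℝ → ℂ} (hφ : Continuous φ) :
    pair (g - h) φ = pair g φ - pair h φ := by
  simp only [pair_eq_inner _ hφ, inner_sub_right]

lemma pair_smul_left (c : ℂ) (g : L2) {φ : ℝ → ℂ} (hφ : Continuous φ) :
    pair (c • g) φ = c * pair g φ := by
  simp only [pair_eq_inner _ hφ, inner_smul_right]

lemma pair_zero_left {φ : ℝ → ℂ} (hφ : Continuous φ) : pair 0 φ = 0 := by
  simp only [pair_eq_inner _ hφ, inner_zero_right]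

lemma pair_const_mul_right (g : L2) (c : ℂ) (φ : ℝ → ℂ) :
    pair g (fun x => c * φ x) = c * pair g φ := by
  simp only [pair, ← integral_const_mul]
  congr 1
  ext x
  ring

/-- The exponential `x ↦ exp (i n x)`. -/
def expMode (n : ℤ) (x : ℝ) : ℂ := exp (I * n * x)

lemma hasDerivAt_expMode (n : ℤ) (x : ℝ) : HasDerivAt (expMode n) (I * n * expMode n x) x := by
  have h := ((hasDerivAt_id x).ofReal_comp.const_mul (I * n)).cexp
  refine h.congr_deriv ?_
  simp [expMode]
  ring

lemma deriv_expMode (n : ℤ) : deriv (expMode n) = fun x => I * n * expMode n x :=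
  funext fun x => (hasDerivAt_expMode n x).deriv

lemma contDiff_expMode (n : ℤ) : ContDiff ℝ ∞ (expMode n) :=
  (contDiff_const.mul Complex.ofRealCLM.contDiff).cexp

lemma continuous_expMode (n : ℤ) : Continuous (expMode n) := (contDiff_expMode n).continuous

lemma periodic_expMode (n : ℤ) : Function.Periodic (expMode n) (2 * Real.pi) := fun x => by
  rw [expMode, expMode, Complex.exp_eq_exp_iff_exists_int]
  exact ⟨n, by push_cast; ring⟩

lemma conj_expMode (n : ℤ) (x : ℝ) : conj (expMode n x) = expMode (-n) x := by
  simp [expMode, ← Complex.exp_conj]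

lemma integral_expMode_mul (m n : ℤ) :
    ∫ x in (0 : ℝ)..(2 * Real.pi), expMode n x * expMode (-m) x =
      if m = n then 2 * (Real.pi : ℂ) else 0 := by
  have h : ∀ x : ℝ, expMode n x * expMode (-m) x = exp (I * (n - m) * x) := fun x => by
    rw [expMode, expMode, ← Complex.exp_add]
    push_cast
    ring_nf
  simp only [h]
  split_ifs with hmn
  · simp [hmn]
  · have hne : I * ((n : ℂ) - m) ≠ 0 :=
      mul_ne_zero I_ne_zero (sub_ne_zero.2 (by exact_mod_cast Ne.symm hmn))
    rw [integral_exp_mul_complex hne]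
    have : exp (I * ((n : ℂ) - m) * ((2 * Real.pi : ℝ) : ℂ)) = 1 := by
      rw [Complex.exp_eq_one_iff]
      exact ⟨n - m, by push_cast; ring⟩
    rw [this]
    simp

/-- The normalisation constant of the Fourier basis. -/
def normConst : ℂ := ((√(2 * Real.pi))⁻¹ : ℝ)

lemma normConst_ne_zero : normConst ≠ 0 := by
  rw [normConst, ne_eq, ofReal_eq_zero]
  have := Real.two_pi_pos
  positivity

lemma normConst_sq : normConst * normConst * (2 * (Real.pi : ℂ)) = 1 := by
  have h := Real.mul_self_sqrt Real.two_pi_pos.le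
  have h0 : √(2 * Real.pi) ≠ 0 := (Real.sqrt_pos.2 Real.two_pi_pos).ne'
  have : (√(2 * Real.pi))⁻¹ * (√(2 * Real.pi))⁻¹ * (2 * Real.pi) = 1 := by
    nth_rewrite 3 [← h]
    field_simp
  rw [normConst]
  exact_mod_cast congrArg ((↑) : ℝ → ℂ) this

/-- The normalised exponential of frequency `n`, as an element of `L²`. -/
def fourierVector (n : ℤ) : L2 := normConst • testVector (expMode (-n)) (continuous_expMode _)

lemma inner_fourierVector (n : ℤ) (g : L2) :
    ⟪fourierVector n, g⟫_ℂ = normConst * pair g (expMode (-n)) := by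
  rw [fourierVector, inner_smul_left, ← pair_eq_inner, normConst, conj_ofReal]

lemma pair_fourierVector (n : ℤ) {φ : ℝ → ℂ} (hφ : Continuous φ) :
    pair (fourierVector n) φ =
      normConst * ∫ x in (0 : ℝ)..(2 * Real.pi), expMode n x * φ x := by
  rw [fourierVector, pair_smul_left _ _ hφ, pair, ← integral_spaceMeasure]
  congr 1
  refine integral_congr_ae ?_
  filter_upwards [coeFn_testVector _ (continuous_expMode (-n))] with x hx
  rw [hx, conj_expMode, neg_neg]

lemma orthonormal_fourierVector : Orthonormal ℂ fourierVector := by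
  rw [orthonormal_iff_ite]
  intro m n
  rw [inner_fourierVector, pair_fourierVector _ (continuous_expMode _), integral_expMode_mul]
  split_ifs
  · rw [← mul_assoc, normConst_sq]
  · simp

/-- Completeness of the exponentials: all the coefficients `fourierCoeffOn` vanish, and Parseval
gives `∫ ‖g‖² = 0`. -/
lemma eq_zero_of_pair_expMode {g : L2} (h : ∀ n, pair g (expMode n) = 0) : g = 0 := by
  have hg : MemLp g 2 (volume.restrict (Set.Ioc 0 (2 * Real.pi))) := by
    rw [← restrict_Ioo_eq_restrict_Ioc]
    exact Lp.memLp g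
  have hc : ∀ n, fourierCoeffOn Real.two_pi_pos g n = 0 := fun n => by
    rw [fourierCoeffOn_eq_integral]
    have := h (-n)
    rw [pair, integral_spaceMeasure] at this
    rw [smul_eq_zero]
    right
    rw [← this]
    refine intervalIntegral.integral_congr fun x _ => ?_
    simp only [fourier_coe_apply, expMode, smul_eq_mul]
    rw [mul_comm]
    congr 2
    have : (Real.pi : ℂ) ≠ 0 := by exact_mod_cast Real.pi_ne_zero
    push_cast
    field_simp
    ring
  have hs := (tsum_sq_fourierCoeffOn Real.two_pi_pos hg)
  simp only [hc, norm_zero, ne_eq, OfNat.ofNat_ne_zero, not_false_eq_true, zero_pow, tsum_zero,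
    sub_zero, smul_eq_mul] at hs
  have hz : ∫ x in (0 : ℝ)..(2 * Real.pi), ‖g x‖ ^ 2 = 0 := by
    have := Real.two_pi_pos
    rcases mul_eq_zero.1 hs.symm with h | h
    · exact absurd h (by positivity)
    · exact h
  have hinner : ⟪g, g⟫_ℂ = ((∫ x in (0 : ℝ)..(2 * Real.pi), ‖g x‖ ^ 2 : ℝ) : ℂ) := by
    rw [L2.inner_def, integral_spaceMeasure, ← intervalIntegral.integral_ofReal]
    refine intervalIntegral.integral_congr fun x _ => ?_
    simp only [inner_self_eq_norm_sq_to_K, ofReal_pow]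
    rfl
  rw [← inner_self_eq_zero (𝕜 := ℂ), hinner, hz, ofReal_zero]

lemma span_fourierVector_orthogonal : (Submodule.span ℂ (Set.range fourierVector))ᗮ = ⊥ := by
  rw [Submodule.eq_bot_iff]
  intro g hg
  refine eq_zero_of_pair_expMode fun n => ?_
  have := (Submodule.mem_orthogonal _ g).1 hg (fourierVector (-n))
    (Submodule.subset_span ⟨-n, rfl⟩)
  rw [inner_fourierVector, neg_neg] at this
  exact (mul_eq_zero.1 this).resolve_left normConst_ne_zero

/-- The Hilbert basis of exponentials. -/
def fourierHilbertBasis : HilbertBasis ℤ ℂ L2 :=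
  HilbertBasis.mkOfOrthogonalEqBot orthonormal_fourierVector span_fourierVector_orthogonal

lemma coe_fourierHilbertBasis (n : ℤ) : fourierHilbertBasis n = fourierVector n := by
  rw [fourierHilbertBasis, HilbertBasis.coe_mkOfOrthogonalEqBot]

/-- The `n`-th Fourier coefficient. -/
def coeff (n : ℤ) : L2 →L[ℂ] ℂ := innerSL ℂ (fourierVector n)

lemma coeff_eq_pair (n : ℤ) (g : L2) : coeff n g = normConst * pair g (expMode (-n)) := by
  rw [coeff, innerSL_apply_apply, inner_fourierVector]

lemma coeff_eq_repr (n : ℤ) (g : L2) : coeff n g = fourierHilbertBasis.repr g n := by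
  rw [HilbertBasis.repr_apply_apply, coe_fourierHilbertBasis, coeff, innerSL_apply_apply]

lemma memℓp_coeff (g : L2) : Memℓp (fun n => coeff n g) 2 := by
  simp only [coeff_eq_repr]
  exact lp.memℓp _

lemma integral_expMode_mul_deriv {φ : ℝ → ℂ} (hφ : ContDiff ℝ ∞ φ)
    (hper : Function.Periodic φ (2 * Real.pi)) (n : ℤ) :
    ∫ x in (0 : ℝ)..(2 * Real.pi), expMode n x * deriv φ x =
      -(I * n) * ∫ x in (0 : ℝ)..(2 * Real.pi), expMode n x * φ x := by
  have hd : Differentiable ℝ φ := hφ.differentiable (by simp)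
  have hc : Continuous (deriv φ) := hφ.continuous_deriv (by simp)
  have he := continuous_expMode n
  rw [intervalIntegral.integral_mul_deriv_eq_deriv_mul (u := expMode n) (v := φ)
    (u' := fun x => I * n * expMode n x) (fun x _ => hasDerivAt_expMode n x)
    (fun x _ => (hd x).hasDerivAt) (Continuous.intervalIntegrable (by fun_prop) _ _)
    (hc.intervalIntegrable _ _)]
  have h1 : expMode n (2 * Real.pi) = expMode n 0 := by simpa using periodic_expMode n 0
  have h2 : φ (2 * Real.pi) = φ 0 := by simpa using hper 0
  rw [h1, h2, sub_self, zero_sub, neg_mul, ← intervalIntegral.integral_const_mul]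
  simp only [mul_assoc]

/-- If `g = -∂ₓ h` on the Fourier side, then `g = -∂ₓ h` weakly on the circle. -/
lemma pair_eq_pair_deriv {g h : L2} (hgh : ∀ n : ℤ, coeff n g = -(I * n) * coeff n h)
    {φ : ℝ → ℂ} (hφ : ContDiff ℝ ∞ φ) (hper : Function.Periodic φ (2 * Real.pi)) :
    pair g φ = pair h (deriv φ) := by
  have hc : Continuous (deriv φ) := hφ.continuous_deriv (by simp)
  -- Both pairings are expanded by Parseval and compared term by term; the integration by parts
  -- falls on the smooth test function, so `h` need not be differentiable.
  rw [pair_eq_inner g hφ.continuous, pair_eq_inner h hc,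
    ← fourierHilbertBasis.tsum_inner_mul_inner, ← fourierHilbertBasis.tsum_inner_mul_inner]
  refine tsum_congr fun n => ?_
  have hg := hgh n
  rw [coeff, innerSL_apply_apply, innerSL_apply_apply] at hg
  rw [coe_fourierHilbertBasis, ← pair_eq_inner, ← pair_eq_inner, hg,
    pair_fourierVector _ hφ.continuous, pair_fourierVector _ hc, integral_expMode_mul_deriv hφ hper]
  ring

/-- A family of Fourier coefficients, continuous in time and dominated by a square summable
sequence, defines a continuous curve in `L²`. -/
lemma exists_continuous_of_coeff {c : ℝ → ℤ → ℂ} {m : ℤ → ℝ} (hm : Memℓp m 2)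
    (hc : ∀ n, Continuous fun t => c t n) (hcm : ∀ t n, ‖c t n‖ ≤ m n) :
    ∃ g : ℝ → L2, Continuous g ∧ ∀ t n, coeff n (g t) = c t n := by
  have hms : Summable fun n => m n ^ 2 := by
    have := hm.summable (by simp)
    simpa using this
  have hmem : ∀ t, Memℓp (c t) 2 := fun t => by
    refine memℓp_gen ?_
    simp only [ENNReal.toReal_ofNat, Real.rpow_ofNat]
    exact Summable.of_nonneg_of_le (fun n => by positivity)
      (fun n => pow_le_pow_left₀ (norm_nonneg _) (hcm t n) 2) hms
  obtain ⟨G, hG⟩ : ∃ G : ℝ → lp (fun _ : ℤ => ℂ) 2, ∀ t n, G t n = c t n :=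
    ⟨fun t => ⟨c t, hmem t⟩, fun t n => rfl⟩
  have hGc : Continuous G := by
    rw [continuous_iff_continuousAt]
    intro t
    rw [ContinuousAt, tendsto_iff_norm_sub_tendsto_zero]
    have hsq : ∀ s, ‖G s - G t‖ ^ 2 = ∑' n, ‖c s n - c t n‖ ^ 2 := fun s => by
      have := lp.norm_rpow_eq_tsum (p := 2) (by simp) (G s - G t)
      simp only [ENNReal.toReal_ofNat, Real.rpow_ofNat] at this
      rw [this]
      simp [hG]
    have hlim : Filter.Tendsto (fun s => ‖G s - G t‖ ^ 2) (nhds t) (nhds 0) := by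
      simp only [hsq]
      have h0 : (0 : ℝ) = ∑' n : ℤ, (0 : ℝ) := by simp
      rw [h0]
      -- The majorant does not depend on time, so continuity of each coefficient passes to the `ℓ²`
      -- norm.
      refine tendsto_tsum_of_dominated_convergence (bound := fun n => 4 * m n ^ 2)
        (hms.mul_left 4) (fun n => ?_) (Filter.Eventually.of_forall fun s n => ?_)
      · have : Continuous fun s => ‖c s n - c t n‖ ^ 2 := by
          have := hc n
          fun_prop
        simpa using this.tendsto t
      · have h1 : ‖c s n - c t n‖ ≤ 2 * m n :=
          (norm_sub_le _ _).trans (by linarith [hcm s n, hcm t n])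
        rw [Real.norm_of_nonneg (by positivity)]
        calc ‖c s n - c t n‖ ^ 2 ≤ (2 * m n) ^ 2 := pow_le_pow_left₀ (norm_nonneg _) h1 2
          _ = 4 * m n ^ 2 := by ring
    have := hlim.sqrt
    simpa using this
  refine ⟨fun t => fourierHilbertBasis.repr.symm (G t),
    fourierHilbertBasis.repr.symm.continuous.comp hGc, fun t n => ?_⟩
  rw [coeff_eq_repr, LinearIsometryEquiv.apply_symm_apply, hG]

lemma ext_coeff {g h : L2} (hgh : ∀ n, coeff n g = coeff n h) : g = h := by
  apply fourierHilbertBasis.repr.injective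
  ext n
  rw [← coeff_eq_repr, ← coeff_eq_repr, hgh]

end MaxwellNS

/-! ### Weak solutions: uniqueness, existence and assembly of the modes -/

namespace MaxwellNS

open scoped InnerProductSpace ENNReal
open Complex

/-- The retraction of the line onto `[0, T]`. -/
def clamp (T t : ℝ) : ℝ := max 0 (min T t)

lemma continuous_clamp (T : ℝ) : Continuous (clamp T) := by
  unfold clamp
  fun_prop

lemma clamp_mem {T : ℝ} (hT : 0 ≤ T) (t : ℝ) : clamp T t ∈ Set.Icc 0 T :=
  ⟨le_max_left _ _, max_le hT (min_le_left _ _)⟩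

lemma clamp_of_mem {T t : ℝ} (ht : t ∈ Set.Icc 0 T) : clamp T t = t := by
  rw [clamp, min_eq_right ht.2, max_eq_right ht.1]

/-- Uniqueness for linear integral equations in `ℂ³`. -/
lemma eqOn_of_integral_system {T : ℝ} (hT : 0 ≤ T) (A : Matrix (Fin 3) (Fin 3) ℂ)
    {g : ℝ → Fin 3 → ℂ} (hg : Continuous g) (c : Fin 3 → ℂ) {x y : ℝ → Fin 3 → ℂ}
    (hx : ContinuousOn x (Set.Icc 0 T)) (hy : ContinuousOn y (Set.Icc 0 T))
    (hxe : ∀ t ∈ Set.Icc 0 T, ∀ i, x t i = c i + ∫ s in (0 : ℝ)..t, (A.mulVec (x s) i + g s i))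
    (hye : ∀ t ∈ Set.Icc 0 T, ∀ i, y t i = c i + ∫ s in (0 : ℝ)..t, (A.mulVec (y s) i + g s i)) :
    Set.EqOn x y (Set.Icc 0 T) := by
  obtain ⟨B, hB⟩ : ∃ B : (Fin 3 → ℂ) →L[ℂ] (Fin 3 → ℂ), ∀ v, B v = A.mulVec v :=
    ⟨(Matrix.mulVecLin A).toContinuousLinearMap, fun v => rfl⟩
  simp only [← hB] at hxe hye
  have key : ∀ w : ℝ → Fin 3 → ℂ, ContinuousOn w (Set.Icc 0 T) →
      (∀ t ∈ Set.Icc 0 T, ∀ i, w t i = c i + ∫ s in (0 : ℝ)..t, (B (w s) i + g s i)) →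
      ∃ W : ℝ → Fin 3 → ℂ, Set.EqOn w W (Set.Icc 0 T) ∧ W 0 = c ∧
        (∀ t, t ∈ Set.Icc 0 T → HasDerivAt W (B (W t) + g t) t) := by
    intro w hw hwe
    -- Freezing `w` outside `[0, T]` makes the integrand continuous on the line, so the primitive
    -- has two-sided derivatives even at the endpoints.
    have hwc : Continuous fun t => w (clamp T t) :=
      hw.comp_continuous (continuous_clamp T) (clamp_mem hT)
    have hF : ∀ i, Continuous fun s => B (w (clamp T s)) i + g s i := fun i =>
      ((continuous_apply i).comp (B.continuous.comp hwc)).add ((continuous_apply i).comp hg)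
    have hEq : Set.EqOn w (fun t i => c i + ∫ s in (0 : ℝ)..t, (B (w (clamp T s)) i + g s i))
        (Set.Icc 0 T) := by
      intro t ht
      ext i
      rw [hwe t ht i]
      congr 1
      refine intervalIntegral.integral_congr fun s hs => ?_
      rw [Set.uIcc_of_le ht.1] at hs
      simp only [clamp_of_mem (show s ∈ Set.Icc 0 T from ⟨hs.1, hs.2.trans ht.2⟩)]
    refine ⟨_, hEq, by simp, fun t ht => ?_⟩
    have hWt := hEq ht
    beta_reduce at hWt
    rw [← hWt, hasDerivAt_pi]
    intro i
    have := (intervalIntegral.integral_hasDerivAt_right ((hF i).intervalIntegrable 0 t)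
      (hF i).aestronglyMeasurable.stronglyMeasurableAtFilter (hF i).continuousAt).const_add (c i)
    rwa [clamp_of_mem ht] at this
  obtain ⟨X, hxX, hX0, hX⟩ := key x hx hxe
  obtain ⟨Y, hyY, hY0, hY⟩ := key y hy hye
  have hlip : ∀ t : ℝ, LipschitzWith ‖B‖₊ fun v => B v + g t := fun t =>
    LipschitzWith.of_dist_le_mul fun v w => by
      rw [dist_add_right]
      exact B.lipschitz.dist_le_mul v w
  have hXY : Set.EqOn X Y (Set.Icc 0 T) :=
    ODE_solution_unique (v := fun t v => B v + g t) hlip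
      (fun t ht => (hX t ht).continuousAt.continuousWithinAt)
      (fun t ht => (hX t ⟨ht.1, ht.2.le⟩).hasDerivWithinAt)
      (fun t ht => (hY t ht).continuousAt.continuousWithinAt)
      (fun t ht => (hY t ⟨ht.1, ht.2.le⟩).hasDerivWithinAt) (hX0.trans hY0.symm)
  exact fun t ht => (hxX ht).trans ((hXY ht).trans (hyY ht).symm)

lemma continuousOn_pair {g : ℝ → L2} {s : Set ℝ} (hg : ContinuousOn g s) {φ : ℝ → ℂ}
    (hφ : Continuous φ) : ContinuousOn (fun t => pair (g t) φ) s := by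
  simp only [pair_eq_inner _ hφ]
  exact continuousOn_const.inner hg

lemma pair_deriv_expMode (g : L2) (n : ℤ) :
    pair g (deriv (expMode n)) = I * n * pair g (expMode n) := by
  rw [deriv_expMode, pair_const_mul_right]

/-- Solutions are determined by their initial datum and a continuous control. -/
lemma IsSolution.eqOn {p : Params} {T : ℝ} (hT : 0 ≤ T) {f : ℝ → L2} (hf : Continuous f)
    {z₀ : State} {w z : ℝ → State} (hw : IsSolution p T f 0 0 z₀ w)
    (hz : IsSolution p T f 0 0 z₀ z) : Set.EqOn w z (Set.Icc 0 T) := by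
  have key : ∀ n : ℤ, ∀ y : ℝ → State, IsSolution p T f 0 0 z₀ y →
      ContinuousOn (fun t => ![pair (y t).1 (expMode n), pair (y t).2.1 (expMode n),
        pair (y t).2.2 (expMode n)]) (Set.Icc 0 T) ∧
      ∀ t ∈ Set.Icc 0 T, ∀ i, ![pair (y t).1 (expMode n), pair (y t).2.1 (expMode n),
          pair (y t).2.2 (expMode n)] i =
        ![pair z₀.1 (expMode n), pair z₀.2.1 (expMode n), pair z₀.2.2 (expMode n)] i +
        ∫ s in (0 : ℝ)..t, (Matrix.mulVec !![I * n * p.us, I * n * p.ρs, 0;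
            I * n * p.b, I * n * p.us, -(I * n * (1 / p.ρs : ℂ));
            0, -(I * n * (p.μ / p.κ : ℂ)), -(1 / p.κ : ℂ)]
          ![pair (y s).1 (expMode n), pair (y s).2.1 (expMode n), pair (y s).2.2 (expMode n)] i
          + ![pair (f s) (expMode n), 0, 0] i) := by
    intro n y hy
    have hc := continuous_expMode n
    refine ⟨?_, fun t ht => ?_⟩
    · rw [continuousOn_pi]
      intro i
      fin_cases i
      · exact continuousOn_pair hy.continuousOn.fst hc
      · exact continuousOn_pair hy.continuousOn.snd.fst hc
      · exact continuousOn_pair hy.continuousOn.snd.snd hc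
    · intro i
      fin_cases i
      · refine (hy.density _ (contDiff_expMode n) (periodic_expMode n) t ht).trans
          (congrArg₂ (· + ·) rfl ?_)
        refine intervalIntegral.integral_congr (E := ℂ) fun s _ => ?_
        simp [pair_deriv_expMode, Matrix.mulVec, dotProduct, Fin.sum_univ_three]
        ring
      · refine (hy.velocity _ (contDiff_expMode n) (periodic_expMode n) t ht).trans
          (congrArg₂ (· + ·) rfl ?_)
        refine intervalIntegral.integral_congr (E := ℂ) fun s _ => ?_
        simp [pair_deriv_expMode, Matrix.mulVec, dotProduct, Fin.sum_univ_three,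
          pair_zero_left hc]
        ring
      · refine (hy.stress _ (contDiff_expMode n) (periodic_expMode n) t ht).trans
          (congrArg₂ (· + ·) rfl ?_)
        refine intervalIntegral.integral_congr (E := ℂ) fun s _ => ?_
        simp [pair_deriv_expMode, Matrix.mulVec, dotProduct, Fin.sum_univ_three,
          pair_zero_left hc]
        ring
  intro t ht
  have hmode : ∀ n : ℤ, ![pair (w t).1 (expMode n), pair (w t).2.1 (expMode n),
      pair (w t).2.2 (expMode n)] = ![pair (z t).1 (expMode n), pair (z t).2.1 (expMode n),
      pair (z t).2.2 (expMode n)] := fun n => by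
    have hg : Continuous fun s => (![pair (f s) (expMode n), 0, 0] : Fin 3 → ℂ) := by
      refine continuous_pi fun i => ?_
      fin_cases i
      · exact continuousOn_univ.1 (continuousOn_pair hf.continuousOn (continuous_expMode n))
      · exact continuous_const
      · exact continuous_const
    exact eqOn_of_integral_system hT _ hg _ (key n w hw).1 (key n z hz).1 (key n w hw).2
      (key n z hz).2 ht
  -- The coefficient of index `n` is a pairing with `expMode (-n)`, hence the index `-n` below.
  refine Prod.ext ?_ (Prod.ext ?_ ?_) <;> refine ext_coeff fun n => ?_ <;>
    rw [coeff_eq_pair, coeff_eq_pair] <;> congr 1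
  · exact congrFun (hmode (-n)) 0
  · exact congrFun (hmode (-n)) 1
  · exact congrFun (hmode (-n)) 2

/-- A curve in `L²` whose Fourier coefficients solve `w' = -∂ₓ X + Y` solves it weakly. -/
lemma pair_eq_add_integral {T : ℝ} {W X Y : ℝ → L2} (hX : Continuous X) (hY : Continuous Y)
    (h : ∀ n : ℤ, ∃ w : ℝ → ℂ, ∀ t ∈ Set.Icc 0 T, coeff n (W t) = w t ∧
      HasDerivAt w (-(I * n) * coeff n (X t) + coeff n (Y t)) t)
    {φ : ℝ → ℂ} (hφ : ContDiff ℝ ∞ φ) (hper : Function.Periodic φ (2 * Real.pi))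
    {t : ℝ} (ht : t ∈ Set.Icc 0 T) :
    pair (W t) φ = pair (W 0) φ +
      ∫ s in (0 : ℝ)..t, (pair (X s) (deriv φ) + pair (Y s) φ) := by
  have hc : Continuous (deriv φ) := hφ.continuous_deriv (by simp)
  have hcoeff : ∀ (Z : ℝ → L2), Continuous Z → ∀ n,
      coeff n (∫ s in (0 : ℝ)..t, Z s) = ∫ s in (0 : ℝ)..t, coeff n (Z s) := fun Z hZ n =>
    ((coeff n).intervalIntegral_comp_comm (hZ.intervalIntegrable _ _)).symm
  have hpair : ∀ (Z : ℝ → L2), Continuous Z → ∀ ψ : ℝ → ℂ, Continuous ψ →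
      pair (∫ s in (0 : ℝ)..t, Z s) ψ = ∫ s in (0 : ℝ)..t, pair (Z s) ψ := fun Z hZ ψ hψ => by
    have := (innerSL ℂ (testVector ψ hψ)).intervalIntegral_comp_comm (μ := volume)
      (hZ.intervalIntegrable 0 t)
    simp only [innerSL_apply_apply] at this
    simp only [pair_eq_inner _ hψ, this]
  have hpc : ∀ (Z : ℝ → L2), Continuous Z → ∀ ψ : ℝ → ℂ, Continuous ψ →
      Continuous fun s => pair (Z s) ψ := fun Z hZ ψ hψ =>
    continuousOn_univ.1 (continuousOn_pair hZ.continuousOn hψ)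
  -- Integrating in time first leaves an identity between elements of `L²`, whereas `∂ₓ X` itself
  -- need not lie in `L²`.
  have main := pair_eq_pair_deriv (g := W t - W 0 - ∫ s in (0 : ℝ)..t, Y s)
    (h := ∫ s in (0 : ℝ)..t, X s) (fun n => by
      obtain ⟨w, hw⟩ := h n
      have hsub : ∀ s ∈ Set.uIcc 0 t, s ∈ Set.Icc 0 T := fun s hs => by
        rw [Set.uIcc_of_le ht.1] at hs
        exact ⟨hs.1, hs.2.trans ht.2⟩
      have hftc := intervalIntegral.integral_eq_sub_of_hasDerivAt
        (fun s hs => (hw s (hsub s hs)).2) (Continuous.intervalIntegrable (by fun_prop) _ _)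
      rw [intervalIntegral.integral_add (Continuous.intervalIntegrable (by fun_prop) _ _)
        (Continuous.intervalIntegrable (by fun_prop) _ _),
        intervalIntegral.integral_const_mul, ← hcoeff X hX, ← hcoeff Y hY,
        ← (hw t ht).1, ← (hw 0 ⟨le_rfl, ht.1.trans ht.2⟩).1] at hftc
      rw [map_sub, map_sub, ← hftc]
      ring) hφ hper
  rw [pair_sub_left _ _ hφ.continuous, pair_sub_left _ _ hφ.continuous, hpair Y hY _ hφ.continuous,
    hpair X hX _ hc] at main
  rw [intervalIntegral.integral_add ((hpc X hX _ hc).intervalIntegrable _ _)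
    ((hpc Y hY _ hφ.continuous).intervalIntegrable _ _), ← main]
  ring

lemma coeff_zero_of_integral_eq_zero {g : L2} (h : ∫ x, g x ∂spaceMeasure = 0) :
    coeff 0 g = 0 := by
  rw [coeff_eq_pair, pair]
  simp [expMode, h]

/-- Exact controllability by the density control at every positive time. -/
theorem exactlyControllableByDensity_Zm {p : Params} (hp : p.Admissible) {T : ℝ} (hT : 0 < T) :
    ExactlyControllableByDensity p T Zm := by
  intro z₀ hz₀ z₁ hz₁
  obtain ⟨C, hC, H⟩ := exists_mode_control hp hT
  have hmode := fun n : ℤ => H n (coeff n z₀.1) (coeff n z₀.2.1) (coeff n z₀.2.2)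
    (coeff n z₁.1) (coeff n z₁.2.1) (coeff n z₁.2.2) (by
      rintro rfl
      exact ⟨coeff_zero_of_integral_eq_zero hz₀.1, coeff_zero_of_integral_eq_zero hz₀.2,
        coeff_zero_of_integral_eq_zero hz₁.1, coeff_zero_of_integral_eq_zero hz₁.2⟩)
  choose f r v s hf hr hv hs hr0 hv0 hs0 hr1 hv1 hs1 hbound using hmode
  have hnorm : ∀ g : L2, Memℓp (fun n => ‖coeff n g‖) 2 := fun g => by
    have := memℓp_coeff g
    rw [memℓp_gen_iff (by simp)] at this ⊢
    simpa using this
  -- The uniform modal bound, read as a sequence in `n`, is the square-summable majorant for control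
  -- and state alike. It holds only on `[0, T]`, so the modes are clamped in time.
  have hm := ((((((hnorm z₀.1).add (hnorm z₀.2.1)).add (hnorm z₀.2.2)).add (hnorm z₁.1)).add
    (hnorm z₁.2.1)).add (hnorm z₁.2.2)).const_mul C
  have hcl := continuous_clamp T
  have hcm := clamp_mem hT.le
  have hcont : ∀ {w w' : ℝ → ℂ}, (∀ t, HasDerivAt w (w' t) t) → Continuous w := fun h =>
    continuous_iff_continuousAt.2 fun t => (h t).continuousAt
  obtain ⟨F, hFc, hF⟩ := exists_continuous_of_coeff (c := fun t n => f n (clamp T t)) hm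
    (fun n => (hf n).comp hcl) (fun t n => (hbound n _ (hcm t)).1)
  obtain ⟨R, hRc, hR⟩ := exists_continuous_of_coeff (c := fun t n => r n (clamp T t)) hm
    (fun n => (hcont (hr n)).comp hcl) (fun t n => (hbound n _ (hcm t)).2.1)
  obtain ⟨V, hVc, hV⟩ := exists_continuous_of_coeff (c := fun t n => v n (clamp T t)) hm
    (fun n => (hcont (hv n)).comp hcl) (fun t n => (hbound n _ (hcm t)).2.2.1)
  obtain ⟨S, hSc, hS⟩ := exists_continuous_of_coeff (c := fun t n => s n (clamp T t)) hm
    (fun n => (hcont (hs n)).comp hcl) (fun t n => (hbound n _ (hcm t)).2.2.2)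
  have m0 : (0 : ℝ) ∈ Set.Icc 0 T := ⟨le_rfl, hT.le⟩
  have mT : T ∈ Set.Icc 0 T := ⟨hT.le, le_rfl⟩
  have hR0 : R 0 = z₀.1 := ext_coeff fun n => by rw [hR, clamp_of_mem m0, hr0]
  have hV0 : V 0 = z₀.2.1 := ext_coeff fun n => by rw [hV, clamp_of_mem m0, hv0]
  have hS0 : S 0 = z₀.2.2 := ext_coeff fun n => by rw [hS, clamp_of_mem m0, hs0]
  have hsol : IsSolution p T F 0 0 z₀ fun t => (R t, V t, S t) := by
    refine ⟨(hRc.prodMk (hVc.prodMk hSc)).continuousOn, by simp only [hR0, hV0, hS0],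
      fun φ hφ hper t ht => ?_, fun φ hφ hper t ht => ?_, fun φ hφ hper t ht => ?_⟩
    all_goals
      have hc := hφ.continuous
      have hd : Continuous (deriv φ) := hφ.continuous_deriv (by simp)
    · have := pair_eq_add_integral (W := R)
        (X := fun t => (p.us : ℂ) • R t + (p.ρs : ℂ) • V t) (Y := F) (by fun_prop) hFc
        (fun n => ⟨r n, fun t ht => ⟨by rw [hR, clamp_of_mem ht], (hr n t).congr_deriv (by
          simp only [map_add, map_smul, hR, hV, hF, clamp_of_mem ht, smul_eq_mul])⟩⟩) hφ hper ht
      rw [hR0] at this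
      simpa only [pair_add_left _ _ hd, pair_smul_left _ _ hd] using this
    · have := pair_eq_add_integral (W := V)
        (X := fun t => (p.us : ℂ) • V t + (p.b : ℂ) • R t - (1 / p.ρs : ℂ) • S t) (Y := 0)
        (by fun_prop) continuous_zero
        (fun n => ⟨v n, fun t ht => ⟨by rw [hV, clamp_of_mem ht], (hv n t).congr_deriv (by
          simp only [map_add, map_sub, map_smul, hR, hV, hS, clamp_of_mem ht, smul_eq_mul,
            Pi.zero_apply, map_zero, add_zero])⟩⟩) hφ hper ht
      rw [hV0] at this
      simpa only [pair_add_left _ _ hd, pair_sub_left _ _ hd, pair_smul_left _ _ hd] using this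
    · have := pair_eq_add_integral (W := S)
        (X := fun t => -(p.μ / p.κ : ℂ) • V t) (Y := fun t => -(1 / p.κ : ℂ) • S t)
        (by fun_prop) (by fun_prop)
        (fun n => ⟨s n, fun t ht => ⟨by rw [hS, clamp_of_mem ht], (hs n t).congr_deriv (by
          simp only [map_smul, hV, hS, clamp_of_mem ht, smul_eq_mul]
          ring)⟩⟩) hφ hper ht
      rw [hS0] at this
      rw [this]
      congr 1
      refine intervalIntegral.integral_congr fun τ _ => ?_
      simp only [pair_smul_left _ _ hd, pair_smul_left _ _ hc, Pi.zero_apply, pair_zero_left hc]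
      ring
  refine ⟨F, memLp_restrict_Ioo_of_continuous hFc _ _ 2, fun t => (R t, V t, S t), hsol,
    fun w hw => hw.eqOn hT.le hFc hsol, ?_⟩
  refine Prod.ext ?_ (Prod.ext ?_ ?_) <;> refine ext_coeff fun n => ?_
  · simp only [hR, clamp_of_mem mT, hr1]
  · simp only [hV, clamp_of_mem mT, hv1]
  · simp only [hS, clamp_of_mem mT, hs1]

end MaxwellNS

end

theorem mainTheorem4 (p : MaxwellNS.Params) (hp : p.Admissible) (T : ℝ) (hT : 0 < T) :
    MaxwellNS.ExactlyControllableByDensity p T MaxwellNS.Zm :=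
  MaxwellNS.exactlyControllableByDensity_Zm hp hT
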